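/- **Setting.** Let $d\ge 2$, let $\operatorname{sgn}(a)=1$ for $a>0$ and $\operatorname{sgn}(a)=0$ for $a\le 0$, and let $W^*\in\mathbb R^{d\times d}$ be invertible with unit rows $w_1^*,\dots,w_d^*$ and condition number $\|W^*\|\,\|(W^*)^{-1}\|\le\kappa$. Let $P(X)=\sum_{S\subseteq[d],\,S\ne\emptyset}c_S\prod_{j\in S}X_j$ be a polynomial without constant term with $c_{\{j\}}>0$ for all $j$, monotone (coordinatewise non-decreasing) on $\{0,1\}^d$. For a threshold $t$ put $f(x)=P\big(\operatorname{sgn}(\langle w_1^*,x\rangle-t),\dots,\operatorname{sgn}(\langle w_d^*,x\rangle-t)\big)$. Let $\Phi$ be the standard normal distribution function, and let $\angle(u,v)\in[0,\pi]$ denote the angle between $u$ and $v$. **EstimateTanAlpha$(z,\epsilon_1)$.** For a unit vector $z$, find $t_1,t_2\ge 0$ such that, for $x\sim\mathcal N(0,I_d)$, the probability $\Pr[\operatorname{sgn}(f(x))=1\mid \langle z,x\rangle\in[t'-\epsilon_1,t']]$ equals $0.4$ at $t'=t_1$ and $0.6$ at $t'=t_2$; return $\frac{t_2-t_1}{\Phi^{-1}(0.6)-\Phi^{-1}(0.4)}$.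 If no such $t_1,t_2$ exist, the call fails; otherwise $t_1,t_2$ are chosen by an arbitrary fixed rule that depends measurably on $z$. **RefineEstimate$(\epsilon_1,\epsilon_2)$.** Given the current unit vector $z$, one iteration does the following. Let $s$ be the output of EstimateTanAlpha$(z,\epsilon_1)$ and $\alpha=\tan^{-1}(s)$. Draw a fresh standard Gaussian vector $\Delta z$ in the hyperplane normal to $z$, let $z'$ be the projection of $z+0.1\sin(\alpha/d)\,\Delta z$ to the unit sphere, let $s'$ be the output of EstimateTanAlpha$(z',\epsilon_1)$ and $\alpha'=\tan^{-1}(s')$. If $\alpha'\le\alpha-0.01\,\alpha/d$, the iteration is *successful* and $z$ is replaced by $z'$. Repeat until $\alpha'\le\epsilon_2$. (An iteration in which a call of EstimateTanAlpha fails changes nothing.) **Theorem.** There are absolute constants $c\in(0,1)$ and $C,p>0$ such that for every $\kappa$ there are $A,b>0$ and $q\in\mathbb N$, depending only on $\kappa$, with the following property. In the setting above let $t\ge A\sqrt{\log d}$, let $i\in[d]$, $0<\epsilon<1$ and $0<\epsilon_1\le b\epsilon/d$, and let $z$ be a unit vector with $\angle(z,w_i^*)\le d^{-q}$. 1. *(One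 iteration.)* If $\angle(z,w_i^*)\ge\epsilon$, then one iteration at $z$ is successful and gives a vector $z'$ with $\angle(z',w_i^*)\le(1-\frac cd)\angle(z,w_i^*)$ with probability at least $p$; and the probability that it is successful but $\angle(z',w_i^*)>(1-\frac cd)\angle(z,w_i^*)$ is at most $e^{-d}$. 2. *($O(T)$ iterations.)* Let $\angle(z,w_i^*)\le\gamma$ and let $T,N\ge0$ be integers with $N\ge CT$. With probability at least $1-e^{-T}-e^{-d}$, the vector $z^*$ held by RefineEstimate$(\epsilon_1,\epsilon/2)$, started at $z$, after at most $N$ iterations (fewer if it stops) is a unit vector with $\angle(z^*,w_i^*)\le\max\{(1-\frac cd)^T\gamma,\ \epsilon\}$. 3. *($O(d\log(1/\epsilon))$ iterations.)* For every integer $N\ge C\,d\log(1/\epsilon)$, with probability at least $1-e^{-d}$ the vector $z^*$ held by RefineEstimate$(\epsilon_1,\epsilon/2)$, started at $z$, after at most $N$ iterations is a unit vector with $\angle(z^*,w_i^*)\le\epsilon$. -/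

import Mathlib

open MeasureTheory ProbabilityTheory

noncomputable section

namespace HighThreshold

/-- The input space `ℝ^d` with its Euclidean norm. -/
abbrev Vec (d : ℕ) := EuclideanSpace ℝ (Fin d)

/-! ### The network -/

/-- The sign activation with values in `{0, 1}`. -/
def sgn (a : ℝ) : ℝ := if 0 < a then 1 else 0

/-- The polynomial `P(X) = ∑_S c_S ∏_{j ∈ S} X_j`, of degree at most one in each variable. -/
def polyEval {d : ℕ} (c : Finset (Fin d) → ℝ) (X : Fin d → ℝ) : ℝ :=
  ∑ S : Finset (Fin d), c S * ∏ j ∈ S, X j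

/-- The `i`-th weight vector, the `i`-th row of `W`. -/
def weight {d : ℕ} (W : Matrix (Fin d) (Fin d) ℝ) (i : Fin d) : Vec d := WithLp.toLp 2 (W i)

/-- The network `f(x) = P(u(w₁ᵀx), …, u(w_dᵀx))` with `u(a) = sgn (a - t)`. -/
def network {d : ℕ} (c : Finset (Fin d) → ℝ) (W : Matrix (Fin d) (Fin d) ℝ) (t : ℝ)
    (x : Vec d) : ℝ :=
  polyEval c (fun i => sgn (inner ℝ (weight W i) x - t))

/-- The condition number `‖W‖ ‖W⁻¹‖` in the spectral norm (meaningful for invertible `W`). -/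
def condNumber {d : ℕ} (W : Matrix (Fin d) (Fin d) ℝ) : ℝ :=
  ‖Matrix.toEuclideanCLM (𝕜 := ℝ) W‖ * ‖Matrix.toEuclideanCLM (𝕜 := ℝ) W⁻¹‖

/-! ### EstimateTanAlpha -/

/-- The band `l(z, s, ε) = {x : zᵀx ∈ [s - ε, s]}`. -/
def band {d : ℕ} (z : Vec d) (s ε : ℝ) : Set (Vec d) := {x | inner ℝ z x ∈ Set.Icc (s - ε) s}

/-- `Pr[sgn(f(x)) = 1 | x ∈ l(z, s, ε)]` for a standard Gaussian `x`. -/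
def bandProb {d : ℕ} (f : Vec d → ℝ) (ε : ℝ) (z : Vec d) (s : ℝ) : ℝ :=
  ((stdGaussian (Vec d))[|band z s ε]).real {x | sgn (f x) = 1}

/-- `Φ⁻¹(p)`, the quantile function of the standard normal distribution. -/
def normalQuantile (p : ℝ) : ℝ := sInf {x : ℝ | p ≤ cdf (gaussianReal 0 1) x}

/-- `(t₁, t₂)` are nonnegative thresholds at which the band probability is `0.4` and `0.6`. -/
def IsThresholdPair {d : ℕ} (f : Vec d → ℝ) (ε : ℝ) (z : Vec d) (τ : ℝ × ℝ) : Prop :=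
  0 ≤ τ.1 ∧ 0 ≤ τ.2 ∧ bandProb f ε z τ.1 = 0.4 ∧ bandProb f ε z τ.2 = 0.6

/-- A (measurable) rule for the search "find `t₁` and `t₂`": at every unit vector at which
suitable thresholds exist it returns some of them; nothing is said about which ones. -/
structure IsThresholdRule {d : ℕ} (f : Vec d → ℝ) (ε : ℝ) (find : Vec d → ℝ × ℝ) : Prop where
  measurable : Measurable find
  finds : ∀ z : Vec d, ‖z‖ = 1 → (∃ τ, IsThresholdPair f ε z τ) → IsThresholdPair f ε z (find z)

/-- The value `(t₂ - t₁) / (Φ⁻¹(0.6) - Φ⁻¹(0.4))` returned by EstimateTanAlpha. -/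
def estimateTanAlpha {d : ℕ} (find : Vec d → ℝ × ℝ) (z : Vec d) : ℝ :=
  ((find z).2 - (find z).1) / (normalQuantile 0.6 - normalQuantile 0.4)

/-- The resulting estimate `tan⁻¹(s)` of the angle. -/
def estimateAngle {d : ℕ} (find : Vec d → ℝ × ℝ) (z : Vec d) : ℝ :=
  Real.arctan (estimateTanAlpha find z)

/-! ### RefineEstimate -/

/-- The perturbed vector `z + 0.1 sin(α/d) Δz`, projected back to the unit sphere. Here `Δz` is
the projection of `g` to the hyperplane normal to `z`; if `g` is standard Gaussian on `ℝ^d` and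
`z` a unit vector, then `Δz` is standard Gaussian on that hyperplane. -/
def perturb {d : ℕ} (α : ℝ) (z g : Vec d) : Vec d :=
  let y : Vec d := z + (0.1 * Real.sin (α / d)) • (g - (inner ℝ z g : ℝ) • z)
  ‖y‖⁻¹ • y

/-- The candidate `z'` of one iteration at `z`, for the Gaussian sample `g`. -/
def candidate {d : ℕ} (find : Vec d → ℝ × ℝ) (z g : Vec d) : Vec d :=
  perturb (estimateAngle find z) z g

/-- EstimateTanAlpha succeeds at both `z` and the candidate `z'`. -/
def EstimatesExist {d : ℕ} (f : Vec d → ℝ) (ε₁ : ℝ) (find : Vec d → ℝ × ℝ) (z g : Vec d) : Prop :=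
  IsThresholdPair f ε₁ z (find z) ∧
    IsThresholdPair f ε₁ (candidate find z g) (find (candidate find z g))

/-- The iteration is successful: the estimated angle drops by at least `0.01 α / d`, so that the
candidate replaces `z`. -/
def Accepts {d : ℕ} (f : Vec d → ℝ) (ε₁ : ℝ) (find : Vec d → ℝ × ℝ) (z g : Vec d) : Prop :=
  EstimatesExist f ε₁ find z g ∧
    estimateAngle find (candidate find z g) ≤
      estimateAngle find z - 0.01 * estimateAngle find z / d

/-- The stopping rule `α' ≤ ε₂`. -/
def Stops {d : ℕ} (f : Vec d → ℝ) (ε₁ ε₂ : ℝ) (find : Vec d → ℝ × ℝ) (z g : Vec d) : Prop :=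
  EstimatesExist f ε₁ find z g ∧ estimateAngle find (candidate find z g) ≤ ε₂

open Classical in
/-- One iteration of RefineEstimate with the Gaussian sample `g`. The state is the current vector
together with a flag which says whether the loop has stopped. -/
def refineStep {d : ℕ} (f : Vec d → ℝ) (ε₁ ε₂ : ℝ) (find : Vec d → ℝ × ℝ)
    (s : Vec d × Bool) (g : Vec d) : Vec d × Bool :=
  if s.2 = true then s
  else (if Accepts f ε₁ find s.1 g then candidate find s.1 g else s.1,
    decide (Stops f ε₁ ε₂ find s.1 g))

/-- The state of RefineEstimate, started at `z`, after `N` iterations with samples `g 0, g 1, …`. -/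
def refineState {d : ℕ} (f : Vec d → ℝ) (ε₁ ε₂ : ℝ) (find : Vec d → ℝ × ℝ) (z : Vec d)
    (g : ℕ → Vec d) : ℕ → Vec d × Bool
  | 0 => (z, false)
  | N + 1 => refineStep f ε₁ ε₂ find (refineState f ε₁ ε₂ find z g N) (g N)

/-- The vector held by RefineEstimate after at most `N` iterations. -/
def refineEstimate {d : ℕ} (f : Vec d → ℝ) (ε₁ ε₂ : ℝ) (find : Vec d → ℝ × ℝ) (z : Vec d)
    (N : ℕ) (g : ℕ → Vec d) : Vec d :=
  (refineState f ε₁ ε₂ find z g N).1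

/-- The law of an infinite sequence of independent standard Gaussian vectors in `ℝ^d`. -/
def sampleLaw (d : ℕ) : Measure (ℕ → Vec d) :=
  Measure.infinitePi (fun _ : ℕ => stdGaussian (Vec d))

end HighThreshold

end

/-! Since `P` has no constant term, is monotone and has positive linear coefficients, `sgn (f x) =
1` holds exactly when some `⟨w_j, x⟩` exceeds `t`. On a thin band `⟨z, x⟩ ≈ s`, the part of `x`
orthogonal to `z` is still standard Gaussian. With `θ = ∠(z, w_i)`, neuron `i` then sees `s cos θ +
sin θ · N(0, 1)`. Bounded condition number keeps every other weight a fixed distance `δ` away in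
inner product, so each other neuron would need a deviation of order `δ t`; for `t ≥ A √(log d)`
their total contribution `η` is at most `1 / (80000 d)`. The band probability is therefore `Φ((s cos
θ - t) / sin θ)` up to `η` and the band width, the unknown `t` cancels in `t₂ - t₁`, and the
estimated angle has error at most `θ / (2000 d) + 2 ε₁` (`abs_estimate_sub_angle_le`). This holds
only for `θ ≤ ρ = δ / 40`; further out nothing is known about the estimates.

One iteration: with probability at least `3/100` the Gaussian step has a component of at least one
standard deviation towards `w_i` and norm squared at most `10 d`. The linear gain in `cos θ` then
beats the loss from renormalising, the angle shrinks by the factor `1 - 1/(25 d)`, and the test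
accepts. Conversely, acceptance with accurate estimates forces a true decrease by `1 - 1/(200 d)`.
Only an escape to angle above `ρ` can mislead the test, and this requires a huge `‖g‖`.

Many iterations: `N` is arbitrarily large, so a union bound over escapes is useless. Instead the
escape probability is bounded by a multiple of the current angle (`exp_escape_le`) and paid for by a
supermartingale, `potential`. Its first term, `e^{-d}/4` times `ε` plus the angle, falls in mean by
more than the chance of escape: above `ε/4` because the angle shrinks, below `ε/4` because the loop
stops with probability at least `3/100`. Its second term, `(θ/G)^{200 d} (197/200)^{N-n}` while `θ >
G`, bounds the chance of not reaching the target `G` in the remaining `N - n` iterations. At time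
`N` the potential of a failed state is at least 1, so the failure probability is at most the initial
potential; taking `G` to be the two targets of the theorem finishes the proof. -/

namespace HighThreshold

variable {d : ℕ}

/-! ### The standard normal distribution function -/

/-- The standard normal distribution function. -/
noncomputable abbrev stdCdf (x : ℝ) : ℝ := cdf (gaussianReal 0 1) x

lemma gaussianPDFReal_std (x : ℝ) :
    gaussianPDFReal 0 1 x = (Real.sqrt (2 * Real.pi))⁻¹ * Real.exp (-(x ^ 2) / 2) := by
  simp [gaussianPDFReal_def]

lemma continuous_gaussianPDFReal_std : Continuous (gaussianPDFReal 0 1) := by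
  have : gaussianPDFReal 0 1 =
      fun x => (Real.sqrt (2 * Real.pi))⁻¹ * Real.exp (-(x ^ 2) / 2) :=
    funext gaussianPDFReal_std
  rw [this]; fun_prop

lemma gaussianReal_std_Ioc {a b : ℝ} (h : a ≤ b) :
    (gaussianReal 0 1).real (Set.Ioc a b) = stdCdf b - stdCdf a := by
  rw [stdCdf, stdCdf, cdf_eq_real, cdf_eq_real, ← measureReal_sdiff (Set.Iic_subset_Iic.2 h)
      measurableSet_Iic]
  congr 1; ext x; simp [and_comm]

lemma stdCdf_sub {a b : ℝ} (h : a ≤ b) :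
    stdCdf b - stdCdf a = ∫ x in a..b, gaussianPDFReal 0 1 x := by
  rw [← gaussianReal_std_Ioc h, Measure.real, gaussianReal_apply_eq_integral 0 one_ne_zero,
    ENNReal.toReal_ofReal (integral_nonneg fun x => gaussianPDFReal_nonneg 0 1 x),
    intervalIntegral.integral_of_le h]

lemma sqrt_two_pi_bounds :
    (2.5 : ℝ) ≤ Real.sqrt (2 * Real.pi) ∧ Real.sqrt (2 * Real.pi) ≤ 2.6 := by
  have h1 := Real.pi_gt_d2
  have h2 := Real.pi_lt_d2
  constructor
  · apply Real.le_sqrt_of_sq_le; norm_num; linarith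
  · rw [Real.sqrt_le_left (by norm_num)]; norm_num; linarith

lemma gaussianPDFReal_std_le (x : ℝ) : gaussianPDFReal 0 1 x ≤ 0.4 := by
  rw [gaussianPDFReal_std]
  have h1 : (Real.sqrt (2 * Real.pi))⁻¹ ≤ 0.4 := by
    rw [inv_le_comm₀ (by linarith [sqrt_two_pi_bounds.1]) (by norm_num)]
    linarith [sqrt_two_pi_bounds.1]
  have h2 : Real.exp (-(x ^ 2) / 2) ≤ 1 := Real.exp_le_one_iff.2 (by nlinarith [sq_nonneg x])
  have h3 := Real.exp_pos (-(x ^ 2) / 2)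
  nlinarith

lemma le_gaussianPDFReal_std {x y l : ℝ} (hx : x ^ 2 ≤ y) (hl : 2.6 * l ≤ Real.exp (-y / 2)) :
    l ≤ gaussianPDFReal 0 1 x := by
  rw [gaussianPDFReal_std, inv_mul_eq_div]
  have hs : 0 < Real.sqrt (2 * Real.pi) := by linarith [sqrt_two_pi_bounds.1]
  rw [le_div_iff₀ hs]
  have h2 : Real.exp (-y / 2) ≤ Real.exp (-(x ^ 2) / 2) := Real.exp_le_exp.2 (by linarith)
  rcases le_total l 0 with h | h
  · nlinarith [Real.exp_pos (-(x ^ 2) / 2)]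
  · nlinarith [sqrt_two_pi_bounds.2]

lemma stdCdf_sub_le {a b : ℝ} (h : a ≤ b) : stdCdf b - stdCdf a ≤ 0.4 * (b - a) := by
  rw [stdCdf_sub h]
  calc _ ≤ ∫ x in a..b, (0.4 : ℝ) :=
        intervalIntegral.integral_mono_on h (continuous_gaussianPDFReal_std.intervalIntegrable _ _)
          (by simp) fun x _ => gaussianPDFReal_std_le x
    _ = _ := by simp; ring

lemma le_stdCdf_sub_of_forall {a b l : ℝ} (h : a ≤ b)
    (hl : ∀ x ∈ Set.Icc a b, l ≤ gaussianPDFReal 0 1 x) :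
    l * (b - a) ≤ stdCdf b - stdCdf a := by
  rw [stdCdf_sub h]
  calc _ = ∫ x in a..b, l := by simp; ring
    _ ≤ _ := intervalIntegral.integral_mono_on h (by simp)
          (continuous_gaussianPDFReal_std.intervalIntegrable _ _) hl

lemma le_stdCdf_sub {a b : ℝ} (ha : -1 ≤ a) (h : a ≤ b) (hb : b ≤ 1) :
    0.2 * (b - a) ≤ stdCdf b - stdCdf a := by
  refine le_stdCdf_sub_of_forall h fun x hx => le_gaussianPDFReal_std (y := 1) ?_ ?_
  · nlinarith [hx.1, hx.2]
  · have := Real.add_one_le_exp (-1 / 2 : ℝ)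
    have h2 : (0.52 : ℝ) ≤ Real.exp (-1 / 2) := by
      rw [show (-1 / 2 : ℝ) = -1/4 + -1/4 by norm_num, Real.exp_add]
      have := Real.add_one_le_exp (-1 / 4 : ℝ)
      nlinarith
    linarith

/-- Serves as a lower bound for the Gaussian tail beyond one standard deviation, the source of the
success probability of an iteration. -/
lemma le_stdCdf_two_sub_one : 0.05 ≤ stdCdf 2 - stdCdf 1 := by
  have : (0.05 : ℝ) * (2 - 1) ≤ stdCdf 2 - stdCdf 1 := by
    refine le_stdCdf_sub_of_forall (by norm_num)
      fun x hx => le_gaussianPDFReal_std (y := 4) ?_ ?_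
    · nlinarith [hx.1, hx.2]
    · rw [show (-4 / 2 : ℝ) = -(1 + 1) by norm_num, Real.exp_neg, Real.exp_add,
        le_inv_comm₀ (by norm_num) (by positivity)]
      have := Real.exp_one_lt_d9
      have h0 := Real.exp_pos 1
      nlinarith
  linarith

lemma stdCdf_strictMono : StrictMono stdCdf := by
  intro a b hab
  have : 0 < stdCdf b - stdCdf a := by
    rw [stdCdf_sub hab.le]
    exact intervalIntegral.intervalIntegral_pos_of_pos
      (continuous_gaussianPDFReal_std.intervalIntegrable _ _)
      (fun x => gaussianPDFReal_pos 0 1 x one_ne_zero) hab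
  linarith

lemma stdCdf_continuous : Continuous stdCdf := by
  have : LipschitzWith 1 stdCdf := by
    refine LipschitzWith.of_le_add fun x y => ?_
    rcases le_total x y with h | h
    · linarith [stdCdf_strictMono.monotone h, dist_nonneg (x := x) (y := y)]
    · have := stdCdf_sub_le h
      rw [Real.dist_eq, abs_of_nonneg (by linarith)]
      linarith
  exact this.continuous

lemma gaussianReal_std_Ioi (x : ℝ) : (gaussianReal 0 1).real (Set.Ioi x) = stdCdf (-x) := by
  have : NullSingletonClass (gaussianReal 0 1) := nullSingletonClass_gaussianReal one_ne_zero
  rw [stdCdf, cdf_eq_real]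
  have h : (gaussianReal 0 1).map (fun x => -x) = gaussianReal 0 1 := by
    rw [gaussianReal_map_neg]; simp
  conv_lhs => rw [← h]
  rw [map_measureReal_apply measurable_neg measurableSet_Ioi]
  have hs : (fun x : ℝ => -x) ⁻¹' Set.Ioi x = Set.Iio (-x) := by simp
  rw [hs, measureReal_congr Iio_ae_eq_Iic]

lemma stdCdf_neg (x : ℝ) : stdCdf (-x) = 1 - stdCdf x := by
  rw [← gaussianReal_std_Ioi, stdCdf, cdf_eq_real, ← Set.compl_Iic,
    measureReal_compl measurableSet_Iic]
  simp

lemma stdCdf_zero : stdCdf 0 = 1 / 2 := by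
  have := stdCdf_neg 0
  rw [neg_zero] at this
  linarith

/-- The density is at least `0.2` on `[-1, 1]`, so `Φ(±1/2)` already lie outside `(0.4, 0.6)`. The
location in `[-1/2, 1/2]` leaves room to perturb the quantile inside the region where the density
bound holds. -/
lemma normalQuantile_spec {p : ℝ} (h1 : 0.4 ≤ p) (h2 : p ≤ 0.6) :
    stdCdf (normalQuantile p) = p ∧ -(1 / 2) ≤ normalQuantile p ∧ normalQuantile p ≤ 1 / 2 := by
  have ha := le_stdCdf_sub (a := -(1/2)) (b := 0) (by norm_num) (by norm_num) (by norm_num)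
  have hb := le_stdCdf_sub (a := 0) (b := 1/2) (by norm_num) (by norm_num) (by norm_num)
  rw [stdCdf_zero] at ha hb
  obtain ⟨x, hx, hpx⟩ := intermediate_value_Icc (show -(1/2 : ℝ) ≤ 1/2 by norm_num)
    stdCdf_continuous.continuousOn (show p ∈ _ from ⟨by linarith, by linarith⟩)
  have : normalQuantile p = x := by
    have hs : {y : ℝ | p ≤ cdf (gaussianReal 0 1) y} = Set.Ici x := by
      ext y
      rw [Set.mem_ofPred_eq, Set.mem_Ici, ← hpx]
      exact stdCdf_strictMono.le_iff_le
    rw [normalQuantile, hs, csInf_Ici]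
  rw [this]
  exact ⟨hpx, hx.1, hx.2⟩

/-! ### The standard Gaussian measure on a Euclidean space -/

lemma map_inner_stdGaussian (v : Vec d) :
    (stdGaussian (Vec d)).map (fun x => (inner ℝ v x : ℝ)) =
      gaussianReal 0 (‖v‖ ^ 2).toNNReal := by
  have h := IsGaussian.map_eq_gaussianReal (μ := stdGaussian (Vec d)) (innerSL ℝ v)
  rw [integral_strongDual_stdGaussian, variance_dual_stdGaussian, innerSL_apply_norm] at h
  exact h

lemma measurable_inner_left (v : Vec d) : Measurable fun x : Vec d => (inner ℝ v x : ℝ) := by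
  fun_prop

lemma hasLaw_inner_unit {v : Vec d} (hv : ‖v‖ = 1) :
    (stdGaussian (Vec d)).map (fun x => (inner ℝ v x : ℝ)) = gaussianReal 0 1 := by
  rw [map_inner_stdGaussian, hv]; simp

lemma stdGaussian_unit_inner_gt {v : Vec d} (hv : ‖v‖ = 1) (τ : ℝ) :
    (stdGaussian (Vec d)).real {x | τ < (inner ℝ v x : ℝ)} = stdCdf (-τ) := by
  rw [← gaussianReal_std_Ioi, ← hasLaw_inner_unit hv,
    map_measureReal_apply (measurable_inner_left v) measurableSet_Ioi]
  rfl

lemma stdGaussian_inner_gt {v : Vec d} (hv : v ≠ 0) (τ : ℝ) :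
    (stdGaussian (Vec d)).real {x | τ < (inner ℝ v x : ℝ)} = stdCdf (-τ / ‖v‖) := by
  have hn : 0 < ‖v‖ := norm_pos_iff.2 hv
  have h1 : ‖(‖v‖⁻¹ • v)‖ = 1 := norm_smul_inv_norm (𝕜 := ℝ) hv
  rw [neg_div, ← stdGaussian_unit_inner_gt h1]
  congr 1
  ext x
  rw [Set.mem_ofPred_eq, Set.mem_ofPred_eq, real_inner_smul_left, div_lt_iff₀ hn, mul_comm _ ‖v‖,
    mul_inv_cancel_left₀ hn.ne']

/-- Written without dividing by `‖v‖`, so that the degenerate case `v = 0` (angle zero between `z`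
and `w_i`) needs no separate treatment later. -/
lemma stdGaussian_inner_gt_le {v : Vec d} {τ a : ℝ} (h : -(a * ‖v‖) ≤ τ) :
    (stdGaussian (Vec d)).real {x | τ < (inner ℝ v x : ℝ)} ≤ stdCdf a := by
  rcases eq_or_ne v 0 with rfl | hv
  · have : {x : Vec d | τ < (inner ℝ (0 : Vec d) x : ℝ)} = ∅ := by
      ext x; simp at h ⊢; exact h
    rw [this]; simpa using cdf_nonneg _ _
  · rw [stdGaussian_inner_gt hv]
    refine stdCdf_strictMono.monotone ?_
    rw [div_le_iff₀ (norm_pos_iff.2 hv)]; linarith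

lemma lt_stdGaussian_inner_gt {v : Vec d} {τ a : ℝ} (h : τ < -(a * ‖v‖)) :
    stdCdf a < (stdGaussian (Vec d)).real {x | τ < (inner ℝ v x : ℝ)} := by
  rcases eq_or_ne v 0 with rfl | hv
  · have : {x : Vec d | τ < (inner ℝ (0 : Vec d) x : ℝ)} = Set.univ := by
      ext x; simp at h ⊢; exact h
    rw [this, probReal_univ]
    exact (stdCdf_strictMono (lt_add_one a)).trans_le (cdf_le_one _ _)
  · rw [stdGaussian_inner_gt hv]
    refine stdCdf_strictMono ?_
    rw [lt_div_iff₀ (norm_pos_iff.2 hv)]; linarith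

lemma indepFun_inner {u v : Vec d} (h : (inner ℝ u v : ℝ) = 0) :
    IndepFun (fun x : Vec d => (inner ℝ u x : ℝ)) (fun x => (inner ℝ v x : ℝ))
      (stdGaussian (Vec d)) := by
  refine HasGaussianLaw.indepFun_of_covariance_eq_zero ⟨?_⟩ ?_
  · exact isGaussian_map ((innerSL ℝ u).prod (innerSL ℝ v))
  · rw [← covarianceBilin_apply_eq_cov IsGaussian.memLp_two_id, covarianceBilin_stdGaussian]
    exact h

lemma stdGaussian_inter_inner {u v : Vec d} (h : (inner ℝ u v : ℝ) = 0) {s t : Set ℝ}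
    (hs : MeasurableSet s) (ht : MeasurableSet t) :
    (stdGaussian (Vec d)).real ({x | (inner ℝ u x : ℝ) ∈ s} ∩ {x | (inner ℝ v x : ℝ) ∈ t}) =
      (stdGaussian (Vec d)).real {x | (inner ℝ u x : ℝ) ∈ s} *
        (stdGaussian (Vec d)).real {x | (inner ℝ v x : ℝ) ∈ t} := by
  have := (indepFun_inner h).measure_inter_preimage_eq_mul s t hs ht
  rw [Measure.real, Measure.real, Measure.real, ← ENNReal.toReal_mul]
  exact congrArg _ this

lemma stdCdf_neg_le_exp {τ : ℝ} (h : 0 ≤ τ) : stdCdf (-τ) ≤ Real.exp (-τ ^ 2 / 2) := by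
  have hm : HasSubgaussianMGF id 1 (gaussianReal 0 1) := by
    refine ⟨fun t => integrable_exp_mul_gaussianReal t, fun t => ?_⟩
    rw [mgf_id_gaussianReal]; simp
  rw [← gaussianReal_std_Ioi]
  have hs : Set.Ioi τ ⊆ {x : ℝ | τ ≤ id x} := fun x hx => le_of_lt (Set.mem_Ioi.1 hx)
  refine (measureReal_mono hs).trans ((hm.measure_ge_le h).trans_eq ?_)
  simp

lemma stdGaussian_inner_gt_le_exp {v : Vec d} (hv : ‖v‖ ≤ 1) {τ : ℝ} (h : 0 ≤ τ) :
    (stdGaussian (Vec d)).real {x | τ < (inner ℝ v x : ℝ)} ≤ Real.exp (-τ ^ 2 / 2) :=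
  (stdGaussian_inner_gt_le (a := -τ) (by nlinarith [norm_nonneg v])).trans (stdCdf_neg_le_exp h)

/-! ### Tail of `‖x‖²` through an exponential moment -/

lemma integral_exp_sq_gaussianReal :
    ∫ x, Real.exp (x ^ 2 / 4) ∂(gaussianReal 0 1) = Real.sqrt 2 := by
  rw [integral_gaussianReal_eq_integral_smul one_ne_zero]
  have : ∀ x : ℝ, gaussianPDFReal 0 1 x • Real.exp (x ^ 2 / 4) =
      (Real.sqrt (2 * Real.pi))⁻¹ * Real.exp (-(1 / 4) * x ^ 2) := by
    intro x
    rw [gaussianPDFReal_std, smul_eq_mul, mul_assoc, ← Real.exp_add]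
    congr 2; ring
  simp_rw [this]
  rw [integral_const_mul, integral_gaussian, show Real.pi / (1 / 4) = 2 * (2 * Real.pi) by ring,
    Real.sqrt_mul (by norm_num) (2 * Real.pi), mul_left_comm, inv_mul_cancel₀, mul_one]
  have := sqrt_two_pi_bounds.1
  linarith

lemma integrable_exp_sq_gaussianReal :
    Integrable (fun x => Real.exp (x ^ 2 / 4)) (gaussianReal 0 1) := by
  -- A non-integrable function has Bochner integral 0 by convention, whereas the value here is known
  -- to be `√2`.
  by_contra h
  have := integral_undef h
  rw [integral_exp_sq_gaussianReal] at this
  norm_num at this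

lemma integral_exp_norm_sq_stdGaussian :
    Integrable (fun x : Vec d => Real.exp (‖x‖ ^ 2 / 4)) (stdGaussian (Vec d)) ∧
    ∫ x, Real.exp (‖x‖ ^ 2 / 4) ∂(stdGaussian (Vec d)) = Real.sqrt 2 ^ d := by
  have hm : Measurable (WithLp.toLp 2 : (Fin d → ℝ) → Vec d) := by fun_prop
  have hf : Continuous (fun x : Vec d => Real.exp (‖x‖ ^ 2 / 4)) := by fun_prop
  have he : ∀ x : Fin d → ℝ, Real.exp (‖(WithLp.toLp 2 x : Vec d)‖ ^ 2 / 4) =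
      ∏ i, Real.exp (x i ^ 2 / 4) := by
    intro x
    rw [EuclideanSpace.real_norm_sq_eq, Finset.sum_div, Real.exp_sum]
  rw [← map_pi_eq_stdGaussian]
  constructor
  · rw [integrable_map_measure hf.aestronglyMeasurable hm.aemeasurable]
    simp only [Function.comp_def, he]
    exact Integrable.fintype_prod fun _ => integrable_exp_sq_gaussianReal
  · rw [integral_map hm.aemeasurable hf.aestronglyMeasurable]
    simp_rw [he]
    rw [integral_fintype_prod_eq_prod (f := fun (_ : Fin d) y => Real.exp (y ^ 2 / 4))]
    simp [integral_exp_sq_gaussianReal]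

/-- Markov's inequality for `exp (‖x‖² / 4)`, whose mean `√2 ^ d` is at most `exp (d / 2)`. -/
lemma stdGaussian_norm_sq_ge_le (R : ℝ) :
    (stdGaussian (Vec d)).real {x | R ≤ ‖x‖ ^ 2} ≤ Real.exp (d / 2 - R / 4) := by
  obtain ⟨h1, h2⟩ := integral_exp_norm_sq_stdGaussian (d := d)
  have := mul_meas_ge_le_integral_of_nonneg (Filter.Eventually.of_forall fun x =>
    (Real.exp_pos (‖x‖ ^ 2 / 4)).le) h1 (Real.exp (R / 4))
  rw [h2] at this
  have hs : {x : Vec d | R ≤ ‖x‖ ^ 2} = {x | Real.exp (R / 4) ≤ Real.exp (‖x‖ ^ 2 / 4)} := by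
    ext x
    simp only [Set.mem_ofPred_eq, Real.exp_le_exp]
    constructor <;> intro h <;> linarith
  rw [← hs] at this
  have h3 : Real.sqrt 2 ^ d ≤ Real.exp (d / 2) := by
    have : Real.sqrt 2 ≤ Real.exp (1 / 2) := by
      rw [Real.sqrt_le_left (Real.exp_pos _).le, ← Real.exp_nat_mul]
      have := Real.add_one_le_exp (1 : ℝ)
      norm_num at this ⊢; linarith
    calc _ ≤ Real.exp (1 / 2) ^ d := by gcongr
      _ = _ := by rw [← Real.exp_nat_mul]; congr 1; ring
  rw [Real.exp_sub, le_div_iff₀ (Real.exp_pos _)]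
  linarith

/-! ### When the network fires -/

lemma sgn_eq_one_iff {a : ℝ} : sgn a = 1 ↔ 0 < a := by
  unfold sgn; split_ifs with h <;> simp [h]

lemma sgn_eq_zero_or_one (a : ℝ) : sgn a = 0 ∨ sgn a = 1 := by
  unfold sgn; split_ifs <;> simp

lemma polyEval_zero (c : Finset (Fin d) → ℝ) : polyEval c 0 = c ∅ := by
  unfold polyEval
  rw [Finset.sum_eq_single ∅]
  · simp
  · intro S _ hS
    obtain ⟨k, hk⟩ := Finset.nonempty_iff_ne_empty.2 hS
    rw [Finset.prod_eq_zero hk rfl, mul_zero]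
  · simp

lemma polyEval_single (c : Finset (Fin d) → ℝ) (j : Fin d) :
    polyEval c (Pi.single j 1) = c ∅ + c {j} := by
  unfold polyEval
  have : ∀ S ∈ (Finset.univ : Finset (Finset (Fin d))), S ∉ ({∅, {j}} : Finset (Finset (Fin d))) →
      c S * ∏ k ∈ S, (Pi.single j 1 : Fin d → ℝ) k = 0 := by
    intro S _ hS
    have hk : ∃ k ∈ S, k ≠ j := by
      by_contra! h
      apply hS
      rw [Finset.mem_insert, Finset.mem_singleton]
      exact Finset.subset_singleton_iff.1 fun k hk => Finset.mem_singleton.2 (h k hk)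
    obtain ⟨k, hk, hkj⟩ := hk
    rw [Finset.prod_eq_zero hk (by simp [hkj]), mul_zero]
  rw [← Finset.sum_subset (Finset.subset_univ _) this, Finset.sum_pair (by simp)]
  simp

/-- If no neuron fires, the value is the constant term, which is zero. If neuron `j` fires,
monotonicity compares the input with the indicator of `j`, where the polynomial equals `c {j} > 0`.
-/
lemma sgn_network_eq_one_iff {c : Finset (Fin d) → ℝ} (h0 : c ∅ = 0) (h1 : ∀ j, 0 < c {j})
    (hmono : MonotoneOn (polyEval c) {X | ∀ j, X j = 0 ∨ X j = 1})
    (W : Matrix (Fin d) (Fin d) ℝ) (t : ℝ) (x : Vec d) :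
    sgn (network c W t x) = 1 ↔ ∃ j, t < (inner ℝ (weight W j) x : ℝ) := by
  rw [sgn_eq_one_iff, network]
  constructor
  · intro h
    by_contra! hc
    have : (fun i => sgn ((inner ℝ (weight W i) x : ℝ) - t)) = 0 := by
      funext i
      have := hc i
      simp [sgn, this]
    rw [this, polyEval_zero, h0] at h
    exact lt_irrefl _ h
  · rintro ⟨j, hj⟩
    have hle := hmono (a := Pi.single j 1)
      (b := fun i => sgn ((inner ℝ (weight W i) x : ℝ) - t)) ?_
      (fun i => sgn_eq_zero_or_one _) ?_
    · rw [polyEval_single, h0, zero_add] at hle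
      exact (h1 j).trans_le hle
    · intro k
      rcases eq_or_ne k j with rfl | h <;> simp [*]
    · intro k
      rcases eq_or_ne k j with rfl | h
      · simp [sgn, hj]
      · rw [Pi.single_eq_of_ne h]
        rcases sgn_eq_zero_or_one ((inner ℝ (weight W k) x : ℝ) - t) with h | h <;> simp [h]

/-! ### Band probabilities -/

lemma measurableSet_band (z : Vec d) (s ε : ℝ) : MeasurableSet (band z s ε) :=
  measurable_inner_left z measurableSet_Icc

lemma stdGaussian_unit_inner_mem {z : Vec d} (hz : ‖z‖ = 1) {s : Set ℝ} (hs : MeasurableSet s) :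
    (stdGaussian (Vec d)).real {x | (inner ℝ z x : ℝ) ∈ s} = (gaussianReal 0 1).real s := by
  rw [← hasLaw_inner_unit hz, map_measureReal_apply (measurable_inner_left z) hs]
  rfl

lemma band_pos {z : Vec d} (hz : ‖z‖ = 1) (s : ℝ) {ε : ℝ} (hε : 0 < ε) :
    0 < (stdGaussian (Vec d)).real (band z s ε) := by
  have h : (stdGaussian (Vec d)).real (band z s ε) = _ :=
    stdGaussian_unit_inner_mem hz measurableSet_Icc
  rw [h]
  refine lt_of_lt_of_le ?_ (measureReal_mono Set.Ioc_subset_Icc_self)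
  rw [gaussianReal_std_Ioc (by linarith)]
  linarith [stdCdf_strictMono (show s - ε < s by linarith)]

lemma bandProb_eq (f : Vec d → ℝ) (ε : ℝ) (z : Vec d) (s : ℝ) :
    bandProb f ε z s = (stdGaussian (Vec d)).real (band z s ε ∩ {x | sgn (f x) = 1}) /
      (stdGaussian (Vec d)).real (band z s ε) := by
  rw [bandProb, measureReal_def, cond_apply (measurableSet_band z s ε),
    ENNReal.toReal_mul, ENNReal.toReal_inv, inv_mul_eq_div]
  rfl

lemma stdGaussian_band_inter {u v : Vec d} (h : (inner ℝ u v : ℝ) = 0) (s ε τ : ℝ) :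
    (stdGaussian (Vec d)).real (band u s ε ∩ {x | τ < (inner ℝ v x : ℝ)}) =
      (stdGaussian (Vec d)).real (band u s ε) *
        (stdGaussian (Vec d)).real {x | τ < (inner ℝ v x : ℝ)} :=
  stdGaussian_inter_inner h measurableSet_Icc measurableSet_Ioi

/-- The component of `w` orthogonal to the unit vector `z`. -/
noncomputable def orthoPart (z w : Vec d) : Vec d := w - (inner ℝ z w : ℝ) • z

lemma inner_orthoPart {z : Vec d} (hz : ‖z‖ = 1) (w : Vec d) :
    (inner ℝ z (orthoPart z w) : ℝ) = 0 := by
  rw [orthoPart, inner_sub_right, real_inner_smul_right, real_inner_self_eq_norm_sq, hz]; ring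

lemma orthoPart_inner (z w x : Vec d) :
    (inner ℝ w x : ℝ) = (inner ℝ z w : ℝ) * (inner ℝ z x : ℝ) + (inner ℝ (orthoPart z w) x : ℝ) := by
  rw [orthoPart, inner_sub_left, real_inner_smul_left]; ring

lemma norm_orthoPart_sq {z : Vec d} (hz : ‖z‖ = 1) (w : Vec d) :
    ‖orthoPart z w‖ ^ 2 = ‖w‖ ^ 2 - (inner ℝ z w : ℝ) ^ 2 := by
  rw [orthoPart, norm_sub_sq_real, real_inner_smul_right, norm_smul, hz, real_inner_comm,
    Real.norm_eq_abs, mul_one, sq_abs]; ring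

lemma cos_angle_unit {z w : Vec d} (hz : ‖z‖ = 1) (hw : ‖w‖ = 1) :
    Real.cos (InnerProductGeometry.angle z w) = inner ℝ z w := by
  rw [InnerProductGeometry.cos_angle, hz, hw]; simp

lemma norm_orthoPart {z w : Vec d} (hz : ‖z‖ = 1) (hw : ‖w‖ = 1) :
    ‖orthoPart z w‖ = Real.sin (InnerProductGeometry.angle z w) := by
  have h1 := norm_orthoPart_sq hz w
  rw [hw, ← cos_angle_unit hz hw] at h1
  have h2 := Real.sin_sq_add_cos_sq (InnerProductGeometry.angle z w)
  exact (sq_eq_sq₀ (norm_nonneg _) (InnerProductGeometry.sin_angle_nonneg z w)).1 (by linarith)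

section Estimates

variable {f : Vec d → ℝ} {w : Fin d → Vec d} {t ε : ℝ} {z : Vec d} {i : Fin d}

/-- Neuron `i` alone gives a lower bound: its worst position in the band is `⟨z, x⟩ = s - ε`, and
its orthogonal part is independent of the band with standard deviation `sin θ`. -/
lemma stdCdf_lt_bandProb (hf : ∀ x, sgn (f x) = 1 ↔ ∃ j, t < (inner ℝ (w j) x : ℝ))
    (hw : ‖w i‖ = 1) (hε : 0 < ε) (hz : ‖z‖ = 1)
    (hcos : 0 ≤ Real.cos (InnerProductGeometry.angle z (w i))) {s a : ℝ}
    (h : t + a * Real.sin (InnerProductGeometry.angle z (w i)) <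
      (s - ε) * Real.cos (InnerProductGeometry.angle z (w i))) :
    stdCdf a < bandProb f ε z s := by
  set θ := InnerProductGeometry.angle z (w i) with hθ
  rw [bandProb_eq, lt_div_iff₀ (band_pos hz s hε)]
  have h1 := lt_stdGaussian_inner_gt (v := orthoPart z (w i)) (τ := t - (s - ε) * Real.cos θ)
    (a := a) (by rw [norm_orthoPart hz hw, ← hθ]; linarith)
  have h2 := stdGaussian_band_inter (inner_orthoPart hz (w i)) s ε (t - (s - ε) * Real.cos θ)
  have hsub : band z s ε ∩ {x | t - (s - ε) * Real.cos θ < (inner ℝ (orthoPart z (w i)) x : ℝ)} ⊆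
      band z s ε ∩ {x | sgn (f x) = 1} := by
    rintro x ⟨hx, hx'⟩
    refine ⟨hx, (hf x).2 ⟨i, ?_⟩⟩
    have hx1 : s - ε ≤ (inner ℝ z x : ℝ) := hx.1
    have hx2 : t - (s - ε) * Real.cos θ < (inner ℝ (orthoPart z (w i)) x : ℝ) := hx'
    rw [orthoPart_inner z, ← cos_angle_unit hz hw]
    nlinarith [mul_le_mul_of_nonneg_right hx1 hcos]
  have h3 := measureReal_mono (μ := stdGaussian (Vec d)) hsub
  rw [h2] at h3
  have h4 := band_pos hz s hε
  nlinarith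

/-- Union bound. Neuron `i` is taken at its best position `⟨z, x⟩ = s`; every other neuron needs an
orthogonal deviation larger than the margin `r`, which has Gaussian tail probability. -/
lemma bandProb_le (hf : ∀ x, sgn (f x) = 1 ↔ ∃ j, t < (inner ℝ (w j) x : ℝ))
    (hw : ∀ j, ‖w j‖ = 1) (hε : 0 < ε) (hz : ‖z‖ = 1)
    (hcos : 0 ≤ Real.cos (InnerProductGeometry.angle z (w i))) {s a r : ℝ} (hr : 0 ≤ r)
    (hs : ∀ j, j ≠ i → ∀ y ∈ Set.Icc (s - ε) s, (inner ℝ z (w j) : ℝ) * y ≤ t - r)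
    (h : s * Real.cos (InnerProductGeometry.angle z (w i)) ≤
      t + a * Real.sin (InnerProductGeometry.angle z (w i))) :
    bandProb f ε z s ≤ stdCdf a + d * Real.exp (-r ^ 2 / 2) := by
  set θ := InnerProductGeometry.angle z (w i) with hθ
  rw [bandProb_eq, div_le_iff₀ (band_pos hz s hε)]
  have h1 := stdGaussian_inner_gt_le (v := orthoPart z (w i)) (τ := t - s * Real.cos θ)
    (a := a) (by rw [norm_orthoPart hz (hw i), ← hθ]; linarith)
  have hsub : band z s ε ∩ {x | sgn (f x) = 1} ⊆
      (band z s ε ∩ {x | t - s * Real.cos θ < (inner ℝ (orthoPart z (w i)) x : ℝ)}) ∪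
      ⋃ j : Fin d, (band z s ε ∩ {x | r < (inner ℝ (orthoPart z (w j)) x : ℝ)}) := by
    rintro x ⟨hx, hx'⟩
    obtain ⟨j, hj⟩ := (hf x).1 hx'
    rw [orthoPart_inner z] at hj
    rcases eq_or_ne j i with rfl | hji
    · left
      refine ⟨hx, ?_⟩
      have hx2 : (inner ℝ z x : ℝ) ≤ s := hx.2
      rw [← cos_angle_unit hz (hw j)] at hj
      rw [Set.mem_ofPred_eq]
      nlinarith [mul_le_mul_of_nonneg_right hx2 hcos]
    · right
      rw [Set.mem_iUnion]
      refine ⟨j, hx, ?_⟩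
      have := hs j hji _ hx
      rw [Set.mem_ofPred_eq]
      linarith
  refine (measureReal_mono hsub).trans ((measureReal_union_le _ _).trans ?_)
  rw [stdGaussian_band_inter (inner_orthoPart hz _)]
  have h2 : (stdGaussian (Vec d)).real
      (⋃ j : Fin d, (band z s ε ∩ {x | r < (inner ℝ (orthoPart z (w j)) x : ℝ)})) ≤
      ∑ j : Fin d, Real.exp (-r ^ 2 / 2) * (stdGaussian (Vec d)).real (band z s ε) := by
    refine (measureReal_iUnion_fintype_le _).trans (Finset.sum_le_sum fun j _ => ?_)
    rw [stdGaussian_band_inter (inner_orthoPart hz _), mul_comm]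
    refine mul_le_mul_of_nonneg_right (stdGaussian_inner_gt_le_exp ?_ hr) measureReal_nonneg
    rw [norm_orthoPart hz (hw j)]
    exact Real.sin_le_one _
  rw [Finset.sum_const, Finset.card_univ, Fintype.card_fin, nsmul_eq_mul] at h2
  have h4 := band_pos hz s hε
  nlinarith

/-! ### Continuity of the band probability in the threshold -/

lemma measurableSet_fires (hf : ∀ x, sgn (f x) = 1 ↔ ∃ j, t < (inner ℝ (w j) x : ℝ)) :
    MeasurableSet {x | sgn (f x) = 1} := by
  have : {x | sgn (f x) = 1} = ⋃ j, {x | t < (inner ℝ (w j) x : ℝ)} := by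
    ext x; simp [hf]
  rw [this]
  exact MeasurableSet.iUnion fun j => measurable_inner_left (w j) measurableSet_Ioi

lemma continuous_stdGaussian_inter_Iic (F : Set (Vec d)) (hz : ‖z‖ = 1) :
    Continuous fun s : ℝ =>
      (stdGaussian (Vec d)).real ({x | (inner ℝ z x : ℝ) ∈ Set.Iic s} ∩ F) := by
  have key : ∀ a b : ℝ, a ≤ b →
      (stdGaussian (Vec d)).real ({x | (inner ℝ z x : ℝ) ∈ Set.Iic b} ∩ F) ≤
      (stdGaussian (Vec d)).real ({x | (inner ℝ z x : ℝ) ∈ Set.Iic a} ∩ F) + (b - a) := by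
    intro a b hab
    have hsub : {x | (inner ℝ z x : ℝ) ∈ Set.Iic b} ∩ F ⊆
        ({x | (inner ℝ z x : ℝ) ∈ Set.Iic a} ∩ F) ∪ {x | (inner ℝ z x : ℝ) ∈ Set.Ioc a b} := by
      rintro x ⟨hx, hxF⟩
      by_cases h : (inner ℝ z x : ℝ) ≤ a
      · exact Or.inl ⟨h, hxF⟩
      · exact Or.inr ⟨not_le.1 h, hx⟩
    refine (measureReal_mono hsub).trans ((measureReal_union_le _ _).trans ?_)
    rw [stdGaussian_unit_inner_mem hz measurableSet_Ioc, gaussianReal_std_Ioc hab]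
    have := stdCdf_sub_le hab
    linarith
  have : LipschitzWith 1 fun s : ℝ =>
      (stdGaussian (Vec d)).real ({x | (inner ℝ z x : ℝ) ∈ Set.Iic s} ∩ F) := by
    refine LipschitzWith.of_le_add fun x y => ?_
    rcases le_total x y with h | h
    · refine (measureReal_mono ?_).trans (le_add_of_nonneg_right dist_nonneg)
      exact Set.inter_subset_inter_left _ fun u hu => le_trans hu h
    · have := key y x h
      rwa [Real.dist_eq, abs_of_nonneg (by linarith)]
  exact this.continuous

/-- The band is closed while the difference of half-spaces is half-open; they differ by a null
hyperplane. -/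
lemma stdGaussian_band_inter_eq {F : Set (Vec d)} (hF : MeasurableSet F) (hz : ‖z‖ = 1)
    (hε : 0 ≤ ε) (s : ℝ) : (stdGaussian (Vec d)).real (band z s ε ∩ F) =
      (stdGaussian (Vec d)).real ({x | (inner ℝ z x : ℝ) ∈ Set.Iic s} ∩ F) -
      (stdGaussian (Vec d)).real ({x | (inner ℝ z x : ℝ) ∈ Set.Iic (s - ε)} ∩ F) := by
  have hm : ∀ a : ℝ, MeasurableSet {x : Vec d | (inner ℝ z x : ℝ) ∈ Set.Iic a} := fun a =>
    measurable_inner_left z measurableSet_Iic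
  rw [← measureReal_sdiff ?_ ((hm _).inter hF)]
  · have hnull : (stdGaussian (Vec d)).real {x | (inner ℝ z x : ℝ) ∈ ({s - ε} : Set ℝ)} = 0 := by
      have : NullSingletonClass (gaussianReal 0 1) := nullSingletonClass_gaussianReal one_ne_zero
      rw [stdGaussian_unit_inner_mem hz (measurableSet_singleton _)]
      exact measureReal_def .. ▸ by rw [measure_singleton]; rfl
    refine le_antisymm ?_ (measureReal_mono ?_)
    · have hsub : band z s ε ∩ F ⊆ (({x | (inner ℝ z x : ℝ) ∈ Set.Iic s} ∩ F) \
          ({x | (inner ℝ z x : ℝ) ∈ Set.Iic (s - ε)} ∩ F)) ∪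
          {x | (inner ℝ z x : ℝ) ∈ ({s - ε} : Set ℝ)} := by
        rintro x ⟨hx, hxF⟩
        rcases hx.1.eq_or_lt with h | h
        · exact Or.inr h.symm
        · exact Or.inl ⟨⟨hx.2, hxF⟩, fun h' => absurd h (not_lt.2 h'.1)⟩
      refine (measureReal_mono hsub).trans ((measureReal_union_le _ _).trans ?_)
      rw [hnull, add_zero]
    · rintro x ⟨⟨h1, h2⟩, h3⟩
      refine ⟨⟨le_of_not_ge fun h => h3 ⟨h, h2⟩, h1⟩, h2⟩
  · exact Set.inter_subset_inter_left _ fun u hu =>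
      le_trans (Set.mem_Iic.1 hu) (sub_le_self s hε)

lemma continuous_bandProb (hF : MeasurableSet {x | sgn (f x) = 1}) (hz : ‖z‖ = 1) (hε : 0 < ε) :
    Continuous (bandProb f ε z) := by
  have h : ∀ {F : Set (Vec d)}, MeasurableSet F → Continuous fun s =>
      (stdGaussian (Vec d)).real (band z s ε ∩ F) := by
    intro F hF
    simp_rw [stdGaussian_band_inter_eq hF hz hε.le]
    have := continuous_stdGaussian_inter_Iic F hz
    exact this.sub (this.comp (continuous_sub_right ε))
  have h1 := h MeasurableSet.univ
  simp_rw [Set.inter_univ] at h1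
  rw [show bandProb f ε z = _ from funext (bandProb_eq f ε z)]
  exact (h hF).div h1 fun s => (band_pos hz s hε).ne'

end Estimates

/-! ### Accuracy of the angle estimate -/

lemma abs_arctan_sub_arctan_le (x y : ℝ) : |Real.arctan x - Real.arctan y| ≤ |x - y| := by
  have := Convex.norm_image_sub_le_of_norm_deriv_le (f := Real.arctan) (s := Set.univ) (C := 1)
    (x := y) (y := x) (fun u _ => Real.differentiableAt_arctan u) (fun u _ => ?_) convex_univ
    (Set.mem_univ _) (Set.mem_univ _)
  · simpa using this
  · rw [Real.deriv_arctan, Real.norm_eq_abs, abs_of_nonneg (by positivity)]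
    exact div_le_one_of_le₀ (by nlinarith [sq_nonneg u]) (by positivity)

lemma norm_sub_le_angle {z w : Vec d} (hz : ‖z‖ = 1) (hw : ‖w‖ = 1) :
    ‖z - w‖ ≤ InnerProductGeometry.angle z w := by
  refine abs_le_of_sq_le_sq' ?_ (InnerProductGeometry.angle_nonneg z w) |>.2
  rw [norm_sub_sq_real, hz, hw, ← cos_angle_unit hz hw]
  have := Real.one_sub_sq_div_two_le_cos (x := InnerProductGeometry.angle z w)
  linarith

lemma tan_le_two_mul {θ : ℝ} (h0 : 0 ≤ θ) (h1 : θ ≤ 1) : Real.tan θ ≤ 2 * θ := by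
  have hc := Real.one_sub_sq_div_two_le_cos (x := θ)
  have hc' : 1 / 2 ≤ Real.cos θ := by nlinarith
  rw [Real.tan_eq_sin_div_cos, div_le_iff₀ (by linarith)]
  nlinarith [Real.sin_le h0]

/-- The denominator in EstimateTanAlpha is bounded away from zero. -/
lemma normalQuantile_sub_ge : 1 / 2 ≤ normalQuantile 0.6 - normalQuantile 0.4 := by
  obtain ⟨h1, -, -⟩ := normalQuantile_spec (p := 0.4) (by norm_num) (by norm_num)
  obtain ⟨h2, -, -⟩ := normalQuantile_spec (p := 0.6) (by norm_num) (by norm_num)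
  have hle : normalQuantile 0.4 ≤ normalQuantile 0.6 := by
    rw [← stdCdf_strictMono.le_iff_le, h1, h2]; norm_num
  have := stdCdf_sub_le hle
  rw [h1, h2] at this
  linarith

section Estimates

variable {f : Vec d → ℝ} {w : Fin d → Vec d} {t ε δ η : ℝ} {z : Vec d} {i : Fin d}

/-- Moving from `w_i` to `z` changes inner products by at most the angle, so `⟨z, w_j⟩ ≤ 1 - 3δ/4`,
and `(1 - 3δ/4)(1 + δ/4) ≤ 1 - δ/2`. Thus the other neurons stay a margin `δ t / 2` below their
threshold. -/
lemma other_weights_small (hw : ∀ j, ‖w j‖ = 1) (hδ : 0 < δ) (hδ' : δ ≤ 1 / 2)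
    (hsep : ∀ j, j ≠ i → (inner ℝ (w i) (w j) : ℝ) ≤ 1 - δ) (ht : 1 ≤ t) (hε' : ε ≤ δ / 20)
    (hz : ‖z‖ = 1) (hθ : InnerProductGeometry.angle z (w i) ≤ δ / 40) {s : ℝ} (hs0 : 0 ≤ s)
    (hs : s ≤ t * (1 + δ / 4)) {j : Fin d} (hj : j ≠ i) {y : ℝ} (hy : y ∈ Set.Icc (s - ε) s) :
    (inner ℝ z (w j) : ℝ) * y ≤ t - δ * t / 2 := by
  have h1 : (inner ℝ z (w j) : ℝ) ≤ 1 - 3 * δ / 4 := by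
    have h2 : (inner ℝ z (w j) : ℝ) = inner ℝ (w i) (w j) + inner ℝ (z - w i) (w j) := by
      rw [inner_sub_left]; ring
    have h3 := real_inner_le_norm (z - w i) (w j)
    rw [hw j, mul_one] at h3
    have h4 := norm_sub_le_angle hz (hw i)
    have h5 := hsep j hj
    linarith
  have h6 : -1 ≤ (inner ℝ z (w j) : ℝ) := by
    have := abs_real_inner_le_norm z (w j)
    rw [hz, hw j] at this
    linarith [(abs_le.1 this).1]
  -- The band may reach below zero, but only down to `-ε`, where `|⟨z, w_j⟩| ≤ 1` suffices.
  rcases le_total 0 y with h | h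
  · have h7 : (inner ℝ z (w j) : ℝ) * y ≤ (1 - 3 * δ / 4) * (t * (1 + δ / 4)) :=
      (mul_le_mul_of_nonneg_right h1 h).trans
        (mul_le_mul_of_nonneg_left (hy.2.trans hs) (by linarith))
    nlinarith [mul_pos (mul_pos hδ hδ) (show (0 : ℝ) < t by linarith)]
  · have h8 : -ε ≤ y := by linarith [hy.1]
    nlinarith

variable (hf : ∀ x, sgn (f x) = 1 ↔ ∃ j, t < (inner ℝ (w j) x : ℝ))
  (hw : ∀ j, ‖w j‖ = 1) (hδ : 0 < δ) (hδ' : δ ≤ 1 / 2)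
  (hsep : ∀ j, j ≠ i → (inner ℝ (w i) (w j) : ℝ) ≤ 1 - δ) (ht : 1 ≤ t)
  (hη : d * Real.exp (-(δ * t / 2) ^ 2 / 2) ≤ η) (hη0 : 0 < η) (hη' : η ≤ 1 / 100)
  (hε : 0 < ε) (hε' : ε ≤ δ / 20) (hz : ‖z‖ = 1)
  (hθ : InnerProductGeometry.angle z (w i) ≤ δ / 40)

include hδ hδ' hθ in
lemma angle_small_facts : 0 ≤ InnerProductGeometry.angle z (w i) ∧
    InnerProductGeometry.angle z (w i) ≤ 1 / 80 ∧
    0 ≤ Real.sin (InnerProductGeometry.angle z (w i)) ∧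
    1 / 2 ≤ Real.cos (InnerProductGeometry.angle z (w i)) ∧
    1 - InnerProductGeometry.angle z (w i) ^ 2 / 2 ≤
      Real.cos (InnerProductGeometry.angle z (w i)) ∧
    Real.sin (InnerProductGeometry.angle z (w i)) ≤ InnerProductGeometry.angle z (w i) := by
  have h0 := InnerProductGeometry.angle_nonneg z (w i)
  have hc := Real.one_sub_sq_div_two_le_cos (x := InnerProductGeometry.angle z (w i))
  refine ⟨h0, by linarith, InnerProductGeometry.sin_angle_nonneg _ _, ?_, hc, Real.sin_le h0⟩
  nlinarith

include hf hw hδ hδ' hε hz hθ in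
lemma le_of_bandProb_le {s a : ℝ} (h : bandProb f ε z s ≤ stdCdf a) :
    (s - ε) * Real.cos (InnerProductGeometry.angle z (w i)) ≤
      t + a * Real.sin (InnerProductGeometry.angle z (w i)) := by
  by_contra! hc
  have := angle_small_facts hδ hδ' hθ
  exact absurd (stdCdf_lt_bandProb hf (hw i) hε hz (by linarith) hc) (not_lt.2 h)

include hδ hδ' hθ ht hε' in
-- Breaks a circularity: the upper bound on a threshold uses neuron `i` only and needs no a priori
-- range for `s`. It yields the range that the lower bound, which must control the other neurons,
-- requires.
lemma threshold_range {s : ℝ} (h : (s - ε) * Real.cos (InnerProductGeometry.angle z (w i)) ≤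
      t + 1 * Real.sin (InnerProductGeometry.angle z (w i))) : s + ε ≤ t * (1 + δ / 4) := by
  obtain ⟨h0, h1, h2, h3, h4, h5⟩ := angle_small_facts hδ hδ' hθ
  set θ := InnerProductGeometry.angle z (w i)
  by_contra! hc
  have h6 : t * (1 + δ / 4) - 2 * ε ≤ s - ε := by linarith
  have h7 : t * (1 + δ / 8) ≤ s - ε := by nlinarith
  have h8 : t * (1 + δ / 8) * (1 - θ ^ 2 / 2) ≤ t + θ := by
    have : t * (1 + δ / 8) * (1 - θ ^ 2 / 2) ≤ (s - ε) * Real.cos θ := by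
      apply mul_le_mul h7 h4 (by nlinarith)
      nlinarith
    linarith
  have h9 : θ ^ 2 ≤ δ / 40 * (1 / 80) := by nlinarith
  have h10 : (1 + δ / 8) * (1 - θ ^ 2 / 2) ≥ 1 + δ / 16 := by nlinarith
  nlinarith

include hf hw hδ hδ' hsep ht hη hε hε' hz hθ in
lemma lt_of_lt_bandProb {s a : ℝ} (hs0 : 0 ≤ s) (hs : s ≤ t * (1 + δ / 4))
    (h : stdCdf a + η < bandProb f ε z s) :
    t + a * Real.sin (InnerProductGeometry.angle z (w i)) <
      s * Real.cos (InnerProductGeometry.angle z (w i)) := by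
  by_contra! hc
  have hfacts := angle_small_facts hδ hδ' hθ
  have := bandProb_le (r := δ * t / 2) hf hw hε hz (by linarith) (by nlinarith)
    (fun j hj y hy => other_weights_small hw hδ hδ' hsep ht hε' hz hθ hs0 hs hj hy) hc
  linarith

include hf hw hδ hδ' hsep ht hη hη' hε hε' hz hθ in
-- Intermediate value theorem: at `s = 0` the probability is at most `Φ(-1) + η`, and slightly
-- beyond `(t + sin θ) / cos θ` it is at least `Φ(1)`.
lemma exists_bandProb_eq {p : ℝ} (hp : 0.4 ≤ p) (hp' : p ≤ 0.6) :
    ∃ s, 0 ≤ s ∧ bandProb f ε z s = p := by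
  obtain ⟨h0, h1, h2, h3, h4, h5⟩ := angle_small_facts hδ hδ' hθ
  set θ := InnerProductGeometry.angle z (w i) with hθdef
  have hΦ1 := le_stdCdf_sub (a := 0) (b := 1) (by norm_num) (by norm_num) (by norm_num)
  have hΦ2 := le_stdCdf_sub (a := -1) (b := 0) (by norm_num) (by norm_num) (by norm_num)
  rw [stdCdf_zero] at hΦ1 hΦ2
  have hlow : bandProb f ε z 0 ≤ p := by
    by_contra! hc
    have := lt_of_lt_bandProb (a := -1) hf hw hδ hδ' hsep ht hη hε hε' hz hθ le_rfl
      (by positivity) (by linarith)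
    rw [← hθdef] at this
    linarith
  have hS : 0 ≤ (t + Real.sin θ) / Real.cos θ + 2 * ε := by
    have : 0 ≤ (t + Real.sin θ) / Real.cos θ := div_nonneg (by linarith) (by linarith)
    linarith
  have hhigh : p ≤ bandProb f ε z ((t + Real.sin θ) / Real.cos θ + 2 * ε) := by
    by_contra! hc
    have := le_of_bandProb_le (a := 1) hf hw hδ hδ' hε hz hθ (by linarith)
    rw [← hθdef] at this
    have h6 : (t + Real.sin θ) / Real.cos θ * Real.cos θ = t + Real.sin θ :=
      div_mul_cancel₀ _ (by linarith)
    nlinarith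
  obtain ⟨s, hs, hps⟩ := intermediate_value_Icc hS
    (continuous_bandProb (measurableSet_fires hf) hz hε).continuousOn
    (show p ∈ _ from ⟨hlow, hhigh⟩)
  exact ⟨s, hs.1, hps⟩

include hf hw hδ hδ' hsep ht hη hη' hε hε' hz hθ in
lemma exists_isThresholdPair : ∃ τ, IsThresholdPair f ε z τ := by
  obtain ⟨s, hs, h⟩ := exists_bandProb_eq (p := 0.4) hf hw hδ hδ' hsep ht hη hη' hε hε' hz hθ
    le_rfl (by norm_num)
  obtain ⟨s', hs', h'⟩ := exists_bandProb_eq (p := 0.6) hf hw hδ hδ' hsep ht hη hη' hε hε' hz hθ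
    (by norm_num) le_rfl
  exact ⟨(s, s'), hs, hs', h, h'⟩

include hf hw hδ hδ' hsep ht hη hη0 hη' hε hε' hz hθ in
lemma threshold_bounds {s p : ℝ} (hp : 0.4 ≤ p) (hp' : p ≤ 0.6) (hs0 : 0 ≤ s)
    (hs : bandProb f ε z s = p) :
    (s - ε) * Real.cos (InnerProductGeometry.angle z (w i)) ≤
      t + normalQuantile p * Real.sin (InnerProductGeometry.angle z (w i)) ∧
    t + (normalQuantile p - 10 * η) * Real.sin (InnerProductGeometry.angle z (w i)) ≤
      s * Real.cos (InnerProductGeometry.angle z (w i)) := by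
  obtain ⟨h0, h1, h2, h3, h4, h5⟩ := angle_small_facts hδ hδ' hθ
  obtain ⟨hq, hq1, hq2⟩ := normalQuantile_spec hp hp'
  have hup := le_of_bandProb_le hf hw hδ hδ' hε hz hθ (hs.trans hq.symm).le
  refine ⟨hup, ?_⟩
  have hrange : s + ε ≤ t * (1 + δ / 4) :=
    threshold_range hδ hδ' ht hε' hθ (hup.trans (by nlinarith))
  -- With density at least `0.2`, moving the quantile by `10 η` moves the probability by at least `2
  -- η`, which absorbs the contribution `η` of the other neurons.
  have h6 := le_stdCdf_sub (a := normalQuantile p - 10 * η) (b := normalQuantile p)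
    (by linarith) (by linarith) (by linarith)
  rw [hq] at h6
  exact (lt_of_lt_bandProb hf hw hδ hδ' hsep ht hη hε hε' hz hθ hs0 (by linarith)
    (by rw [hs]; linarith)).le

include hf hw hδ hδ' hsep ht hη hη0 hη' hε hε' hz hθ in
-- Subtracting the bounds for the two thresholds cancels `t` and gives `t₂ - t₁ = D tan θ` up to `10
-- η tan θ + ε`. Dividing by `D ≥ 1/2` doubles the error, `tan θ ≤ 2 θ`, and `arctan` is
-- 1-Lipschitz.
lemma abs_estimate_sub_angle_le {τ : ℝ × ℝ} (hτ : IsThresholdPair f ε z τ) :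
    |Real.arctan ((τ.2 - τ.1) / (normalQuantile 0.6 - normalQuantile 0.4)) -
      InnerProductGeometry.angle z (w i)| ≤
      40 * η * InnerProductGeometry.angle z (w i) + 2 * ε := by
  obtain ⟨h0, h1, h2, h3, h4, h5⟩ := angle_small_facts hδ hδ' hθ
  obtain ⟨ha, hb⟩ := threshold_bounds hf hw hδ hδ' hsep ht hη hη0 hη' hε hε' hz hθ le_rfl
    (by norm_num) hτ.1 hτ.2.2.1
  obtain ⟨ha', hb'⟩ := threshold_bounds hf hw hδ hδ' hsep ht hη hη0 hη' hε hε' hz hθ (by norm_num)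
    le_rfl hτ.2.1 hτ.2.2.2
  set θ := InnerProductGeometry.angle z (w i)
  have hD := normalQuantile_sub_ge
  set D := normalQuantile 0.6 - normalQuantile 0.4 with hDdef
  have hc : 0 < Real.cos θ := by linarith
  have hsin : Real.sin θ = Real.tan θ * Real.cos θ := (Real.tan_mul_cos hc.ne').symm
  have htan0 : 0 ≤ Real.tan θ := by rw [Real.tan_eq_sin_div_cos]; positivity
  have htan := tan_le_two_mul h0 (by linarith)
  have hnum : |(τ.2 - τ.1) - D * Real.tan θ| ≤ 10 * η * Real.tan θ + ε := by
    rw [abs_le]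
    rw [hsin] at ha hb ha' hb'
    constructor <;> refine le_of_mul_le_mul_right ?_ hc <;> rw [hDdef] <;> linarith
  have harc : θ = Real.arctan (Real.tan θ) :=
    (Real.arctan_tan (by linarith [Real.pi_gt_three]) (by linarith [Real.pi_gt_three])).symm
  conv_lhs => rw [harc]
  refine (abs_arctan_sub_arctan_le _ _).trans ?_
  have hD0 : 0 < D := by linarith
  have : (τ.2 - τ.1) / D - Real.tan θ = ((τ.2 - τ.1) - D * Real.tan θ) / D := by
    field_simp
  rw [this, abs_div, abs_of_pos hD0, div_le_iff₀ hD0]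
  have h6 : 0 ≤ 40 * η * θ + 2 * ε := by positivity
  have h7 : 10 * η * Real.tan θ ≤ 20 * η * θ := by nlinarith
  nlinarith

end Estimates

/-! ### Geometry of the perturbation -/

lemma norm_one_add_ortho {z : Vec d} (hz : ‖z‖ = 1) (σ : ℝ) (g : Vec d) :
    ‖z + σ • orthoPart z g‖ ^ 2 = 1 + σ ^ 2 * ‖orthoPart z g‖ ^ 2 := by
  rw [norm_add_sq_real, real_inner_smul_right, inner_orthoPart hz, hz, norm_smul, mul_pow,
    Real.norm_eq_abs, sq_abs]
  ring

lemma norm_orthoPart_le {z : Vec d} (hz : ‖z‖ = 1) (g : Vec d) : ‖orthoPart z g‖ ^ 2 ≤ ‖g‖ ^ 2 := by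
  rw [norm_orthoPart_sq hz]; nlinarith [sq_nonneg (inner ℝ z g : ℝ)]

lemma perturb_eq (α : ℝ) (z g : Vec d) :
    perturb α z g = ‖z + (0.1 * Real.sin (α / d)) • orthoPart z g‖⁻¹ •
      (z + (0.1 * Real.sin (α / d)) • orthoPart z g) := rfl

lemma one_le_norm_perturbed {z : Vec d} (hz : ‖z‖ = 1) (σ : ℝ) (g : Vec d) :
    1 ≤ ‖z + σ • orthoPart z g‖ := by
  have := norm_one_add_ortho hz σ g
  have h2 : 0 ≤ σ ^ 2 * ‖orthoPart z g‖ ^ 2 := by positivity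
  nlinarith [norm_nonneg (z + σ • orthoPart z g)]

lemma norm_perturb {z : Vec d} (hz : ‖z‖ = 1) (α : ℝ) (g : Vec d) : ‖perturb α z g‖ = 1 := by
  rw [perturb_eq]
  have h := one_le_norm_perturbed hz (0.1 * Real.sin (α / d)) g
  exact norm_smul_inv_norm (𝕜 := ℝ) (norm_pos_iff.1 (by linarith))

lemma arctan_le_self {x : ℝ} (hx : 0 ≤ x) : Real.arctan x ≤ x := by
  have := abs_arctan_sub_arctan_le x 0
  rw [Real.arctan_zero, sub_zero, sub_zero, abs_of_nonneg hx] at this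
  exact (le_abs_self _).trans this

lemma abs_step_le (α : ℝ) : |0.1 * Real.sin (α / d)| ≤ 0.1 * (|α| / d) := by
  rw [abs_mul, abs_of_pos (by norm_num : (0 : ℝ) < 0.1)]
  have := Real.abs_sin_le_abs (x := α / d)
  rw [abs_div, Nat.abs_cast] at this
  linarith

lemma angle_perturb_le {z : Vec d} (hz : ‖z‖ = 1) (α : ℝ) (g : Vec d) :
    InnerProductGeometry.angle z (perturb α z g) ≤ 0.1 * (|α| / d) * ‖g‖ := by
  rw [perturb_eq]
  set σ := 0.1 * Real.sin (α / d) with hσ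
  have h := one_le_norm_perturbed hz σ g
  have hz0 : z ≠ 0 := by rintro rfl; simp at hz
  rw [InnerProductGeometry.angle_smul_right_of_pos _ _ (inv_pos.2 (by linarith)),
    InnerProductGeometry.angle_add_eq_arctan_of_inner_eq_zero
      (by rw [real_inner_smul_right, inner_orthoPart hz, mul_zero]) hz0, hz, div_one]
  refine (arctan_le_self (norm_nonneg _)).trans ?_
  rw [norm_smul, Real.norm_eq_abs]
  exact mul_le_mul (abs_step_le α)
    ((sq_le_sq₀ (norm_nonneg _) (norm_nonneg _)).1 (norm_orthoPart_le hz g))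
    (norm_nonneg _) (by positivity)

lemma cos_angle_perturb {z w : Vec d} (hz : ‖z‖ = 1) (hw : ‖w‖ = 1) (α : ℝ) (g : Vec d) :
    Real.cos (InnerProductGeometry.angle (perturb α z g) w) *
        ‖z + (0.1 * Real.sin (α / d)) • orthoPart z g‖ =
      Real.cos (InnerProductGeometry.angle z w) +
        0.1 * Real.sin (α / d) * (inner ℝ (orthoPart z w) g : ℝ) := by
  rw [cos_angle_unit (norm_perturb hz α g) hw, cos_angle_unit hz hw, perturb_eq,
    real_inner_smul_left, mul_comm, mul_inv_cancel_left₀, inner_add_left, real_inner_smul_left]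
  · congr 2
    rw [orthoPart, orthoPart, inner_sub_left, inner_sub_left, real_inner_smul_left,
      real_inner_smul_left, real_inner_comm g w]
    ring
  · have h := one_le_norm_perturbed hz (0.1 * Real.sin (α / d)) g
    linarith

lemma cos_sub_cos_le {x y : ℝ} (hx : 0 ≤ x) (hxy : x ≤ y) :
    Real.cos x - Real.cos y ≤ y * (y - x) := by
  rw [Real.cos_sub_cos]
  have h1 : |Real.sin ((x + y) / 2)| ≤ (x + y) / 2 :=
    Real.abs_sin_le_abs.trans_eq (abs_of_nonneg (by linarith))
  have h2 : |Real.sin ((x - y) / 2)| ≤ (y - x) / 2 := by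
    refine Real.abs_sin_le_abs.trans_eq ?_
    rw [abs_of_nonpos (by linarith)]; ring
  have h3 : -(Real.sin ((x + y) / 2) * Real.sin ((x - y) / 2)) ≤ (x + y) / 2 * ((y - x) / 2) := by
    refine (neg_le_abs _).trans ?_
    rw [abs_mul]
    exact mul_le_mul h1 h2 (abs_nonneg _) (by linarith)
  nlinarith

lemma mul_le_sin_of_small {x : ℝ} (h0 : 0 < x) (h1 : x ≤ 1 / 40) : 0.999 * x ≤ Real.sin x := by
  have h2 := Real.sin_gt_sub_cube h0
  have h3 : x ^ 2 ≤ 0.001 := by nlinarith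
  have h4 : x ^ 2 * x ≤ 0.001 * x := mul_le_mul_of_nonneg_right h3 h0.le
  have h5 : x ^ 3 = x ^ 2 * x := by ring
  linarith

lemma step_bounds {α θ : ℝ} (hd : 2 ≤ d) (hθ0 : 0 < θ) (hθ : θ ≤ 1 / 80)
    (hα : |α - θ| ≤ θ / 1000) :
    0.0998 * (θ / d) ≤ 0.1 * Real.sin (α / d) ∧ 0.1 * Real.sin (α / d) ≤ 0.1001 * (θ / d) := by
  have hd' : (2 : ℝ) ≤ d := by exact_mod_cast hd
  have hd0 : (0 : ℝ) < d := by linarith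
  obtain ⟨hα1, hα2⟩ := abs_le.1 hα
  have hr0 : 0 < θ / d := by positivity
  have hr1 : θ / d ≤ 1 / 160 := by rw [div_le_iff₀ hd0]; linarith
  have hx1 : 0.999 * (θ / d) ≤ α / d := by rw [← mul_div_assoc]; gcongr; linarith
  have hx2 : α / d ≤ 1.001 * (θ / d) := by rw [← mul_div_assoc]; gcongr; linarith
  have hx0 : 0 < α / d := by linarith
  have h1 := Real.sin_le hx0.le
  have h2 := mul_le_sin_of_small hx0 (by linarith)
  constructor <;> linarith

/-- Balance of one favourable step, with `q = θ²/n`: the linear term `σ a` gains about `0.1 q`,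
while the normalisation `y ≈ 1 + σ² B / 2` costs about `0.05 q`. The difference exceeds `q / 25`. -/
lemma cos_gain {θ σ a B y c c' n : ℝ} (hn : 2 ≤ n) (hθ0 : 0 < θ) (hθ : θ ≤ 1 / 80)
    (hσ1 : 0.0998 * (θ / n) ≤ σ) (hσ2 : σ ≤ 0.1001 * (θ / n)) (ha : 0.999 * θ ≤ a)
    (hB0 : 0 ≤ B) (hB : B ≤ 10 * n) (hy : 1 ≤ y) (hyB : y ^ 2 = 1 + σ ^ 2 * B)
    (hc0 : 0 ≤ c) (hc1 : c ≤ 1) (hcy : c' * y = c + σ * a) : c + θ * (θ / n) / 25 ≤ c' := by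
  have hn0 : 0 < n := by linarith
  have hr0 : 0 < θ / n := by positivity
  have hr1 : θ / n ≤ 1 / 160 := by rw [div_le_iff₀ hn0]; linarith
  have hσB : σ ^ 2 * B ≤ 0.1004 * (θ * (θ / n)) := by
    have h1 : σ ^ 2 * B ≤ (0.1001 * (θ / n)) ^ 2 * (10 * n) := by
      have : 0 ≤ σ := by linarith
      gcongr
    have h3 : (0.1001 * (θ / n)) ^ 2 * (10 * n) = 0.1001 ^ 2 * 10 * (θ * (θ / n)) := by
      field_simp
    have h4 : 0 < θ * (θ / n) := by positivity
    rw [h3] at h1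
    norm_num at h1 ⊢
    linarith
  have hσa : 0.0996 * (θ * (θ / n)) ≤ σ * a := by
    have h1 : 0.0998 * (θ / n) * (0.999 * θ) ≤ σ * a :=
      mul_le_mul hσ1 ha (by positivity) (by linarith)
    have h4 : 0 < θ * (θ / n) := by positivity
    linarith
  have hq0 : 0 < θ * (θ / n) := by positivity
  have hq1 : θ * (θ / n) ≤ 1 / 1000 := by nlinarith
  generalize θ * (θ / n) = q at *
  have hy' : y ≤ 1 + 0.0502 * q := by
    refine (sq_le_sq₀ (by linarith) (by positivity)).1 ?_
    have h1 : (1 + 0.0502 * q) ^ 2 = 1 + 0.1004 * q + (0.0502 * q) ^ 2 := by ring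
    rw [hyB, h1]
    linarith [sq_nonneg (0.0502 * q)]
  refine le_of_mul_le_mul_right ?_ (show 0 < y by linarith)
  rw [hcy]
  have h0 : (c + q / 25) * y ≤ (c + q / 25) * (1 + 0.0502 * q) :=
    mul_le_mul_of_nonneg_left hy' (by positivity)
  have h1 : c * q ≤ 1 * q := mul_le_mul_of_nonneg_right hc1 hq0.le
  have h2 : q * q ≤ 1 / 1000 * q := mul_le_mul_of_nonneg_right hq1 hq0.le
  linarith

/-- A favourable perturbation brings the vector closer to `w`. -/
lemma angle_perturb_le_of_favourable {z w : Vec d} (hd : 2 ≤ d) (hz : ‖z‖ = 1) (hw : ‖w‖ = 1)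
    {α : ℝ} (hθ0 : 0 < InnerProductGeometry.angle z w)
    (hθ : InnerProductGeometry.angle z w ≤ 1 / 80)
    (hα : |α - InnerProductGeometry.angle z w| ≤ InnerProductGeometry.angle z w / 1000)
    {g : Vec d} (hg : ‖g‖ ^ 2 ≤ 10 * d)
    (hg' : Real.sin (InnerProductGeometry.angle z w) ≤ (inner ℝ (orthoPart z w) g : ℝ)) :
    InnerProductGeometry.angle (perturb α z g) w ≤
      (1 - 1 / 25 / d) * InnerProductGeometry.angle z w := by
  have hd' : (2 : ℝ) ≤ d := by exact_mod_cast hd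
  have hd0 : (0 : ℝ) < d := by linarith
  obtain ⟨hσ1, hσ2⟩ := step_bounds hd hθ0 hθ hα
  have hc : 0 ≤ Real.cos (InnerProductGeometry.angle z w) := by
    have := Real.one_sub_sq_div_two_le_cos (x := InnerProductGeometry.angle z w)
    nlinarith
  have hkey := cos_gain hd' hθ0 hθ hσ1 hσ2
    ((mul_le_sin_of_small hθ0 (by linarith)).trans hg') (sq_nonneg _)
    ((norm_orthoPart_le hz g).trans hg) (one_le_norm_perturbed hz _ g)
    (norm_one_add_ortho hz _ g) hc (Real.cos_le_one _) (cos_angle_perturb hz hw α g)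
  generalize InnerProductGeometry.angle z w = θ at *
  have h1 : 1 / 25 / (d : ℝ) ≤ 1 := by rw [div_le_one hd0]; linarith
  have h0 : 0 ≤ 1 / 25 / (d : ℝ) := by positivity
  have h2 : θ * (θ - (1 - 1 / 25 / d) * θ) = θ * (θ / d) / 25 := by ring
  -- Shrinking the angle by the factor `1 - 1/(25 d)` raises the cosine by at most `θ²/(25 d)`,
  -- which is no more than the gain just established.
  have h3 := cos_sub_cos_le (x := (1 - 1 / 25 / d) * θ) (y := θ) (by nlinarith) (by nlinarith)
  refine (Real.strictAntiOn_cos.le_iff_ge ⟨by nlinarith, ?_⟩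
    ⟨InnerProductGeometry.angle_nonneg _ _, InnerProductGeometry.angle_le_pi _ _⟩).1 (by linarith)
  nlinarith [Real.pi_gt_three]

/-! ### One iteration -/

/-- Near `w` the search succeeds and the estimated angle is accurate. -/
structure IsAccurate (f : Vec d → ℝ) (ε₁ : ℝ) (find : Vec d → ℝ × ℝ) (w : Vec d) (ρ : ℝ) :
    Prop where
  pair : ∀ z, ‖z‖ = 1 → InnerProductGeometry.angle z w ≤ ρ → IsThresholdPair f ε₁ z (find z)
  close : ∀ z, ‖z‖ = 1 → InnerProductGeometry.angle z w ≤ ρ →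
    |estimateAngle find z - InnerProductGeometry.angle z w| ≤
      1 / 2000 / d * InnerProductGeometry.angle z w + 2 * ε₁

section Iteration

variable {f : Vec d → ℝ} {ε ε₁ ρ b : ℝ} {find : Vec d → ℝ × ℝ} {z w g : Vec d}

lemma norm_candidate (hz : ‖z‖ = 1) (g : Vec d) : ‖candidate find z g‖ = 1 := norm_perturb hz _ g

lemma unit_facts (hd : 2 ≤ d) : (0 : ℝ) < 1 / 2000 / d ∧ 1 / 2000 / (d : ℝ) ≤ 1 / 4000 := by
  have hd' : (2 : ℝ) ≤ d := by exact_mod_cast hd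
  refine ⟨by positivity, ?_⟩
  rw [div_le_iff₀ (by linarith)]; linarith

lemma tolerance_le (hb : b ≤ 1 / 16000) (hε : 0 < ε) (hε₁ : ε₁ ≤ b * ε / d) :
    2 * ε₁ ≤ 1 / 2000 / d * (ε / 4) := by
  have h1 : b * ε / d ≤ 1 / 16000 * ε / d := by gcongr
  have h2 : 1 / 2000 / (d : ℝ) * (ε / 4) = 2 * (1 / 16000 * ε / d) := by ring
  linarith

/-- In the unit `u = 1/(2000 d)`, the test demands a relative drop of `20 u` in the estimate. The
two estimates are each off by only a few `u` relative to `max θ (ε/4)`, so a true drop of `10 u`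
survives. The maximum is needed because `2 ε₁` is an absolute error. -/
lemma angle_candidate_le_of_accepts (hA : IsAccurate f ε₁ find w ρ) (hd : 2 ≤ d)
    (hb : b ≤ 1 / 16000) (hε : 0 < ε) (hε₁ : ε₁ ≤ b * ε / d) (hz : ‖z‖ = 1)
    (hθ : InnerProductGeometry.angle z w ≤ ρ)
    (hθ' : InnerProductGeometry.angle (candidate find z g) w ≤ ρ)
    (hacc : Accepts f ε₁ find z g) :
    InnerProductGeometry.angle (candidate find z g) w ≤
      (1 - 1 / 200 / d) * max (InnerProductGeometry.angle z w) (ε / 4) := by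
  obtain ⟨hu0, hu1⟩ := unit_facts hd
  have he := tolerance_le (d := d) hb hε hε₁
  have h1 := (abs_le.1 (hA.close z hz hθ)).2
  have h2 := (abs_le.1 (hA.close _ (norm_candidate hz g) hθ')).1
  have h3 := hacc.2
  have h4 := InnerProductGeometry.angle_nonneg (candidate find z g) w
  have h5 : 0.01 * estimateAngle find z / d = 20 * (1 / 2000 / d) * estimateAngle find z := by ring
  have h6 : 1 / 200 / (d : ℝ) = 10 * (1 / 2000 / d) := by ring
  rw [h5] at h3
  rw [h6]
  set u : ℝ := 1 / 2000 / d
  set θ := InnerProductGeometry.angle z w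
  set θ' := InnerProductGeometry.angle (candidate find z g) w
  set m := max θ (ε / 4)
  have hm1 : θ ≤ m := le_max_left _ _
  have hm2 : ε / 4 ≤ m := le_max_right _ _
  have hm0 : 0 < m := by linarith
  have h7 : 2 * ε₁ ≤ u * m := he.trans (mul_le_mul_of_nonneg_left hm2 hu0.le)
  have h8 : u * θ ≤ u * m := mul_le_mul_of_nonneg_left hm1 hu0.le
  have h9 : estimateAngle find z ≤ (1 + 2 * u) * m := by linarith
  have h10 : estimateAngle find z * (1 - 20 * u) ≤ (1 + 2 * u) * m * (1 - 20 * u) :=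
    mul_le_mul_of_nonneg_right h9 (by linarith)
  have h11 : θ' * (1 - u) ≤ (1 - 10 * u) * m * (1 - u) := by
    have h12 : 0 < u * m := mul_pos hu0 hm0
    have h13 : u * (u * m) ≤ 1 / 4000 * (u * m) := mul_le_mul_of_nonneg_right hu1 h12.le
    nlinarith
  exact le_of_mul_le_mul_right h11 (by linarith)

/-- A favourable perturbation lowers the true angle by `80 u`, with `u = 1/(2000 d)`; this exceeds
the `20 u` of the test by far more than the estimation errors. -/
lemma accepts_of_favourable (hA : IsAccurate f ε₁ find w ρ) (hd : 2 ≤ d) (hρ : ρ ≤ 1 / 80)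
    (hb : b ≤ 1 / 16000) (hε : 0 < ε) (hε₁ : ε₁ ≤ b * ε / d) (hz : ‖z‖ = 1) (hw : ‖w‖ = 1)
    (hθ : InnerProductGeometry.angle z w ≤ ρ)
    (hθε : ε / 4 ≤ InnerProductGeometry.angle z w) (hg : ‖g‖ ^ 2 ≤ 10 * d)
    (hg' : Real.sin (InnerProductGeometry.angle z w) ≤ (inner ℝ (orthoPart z w) g : ℝ)) :
    Accepts f ε₁ find z g ∧ InnerProductGeometry.angle (candidate find z g) w ≤
      (1 - 1 / 200 / d) * InnerProductGeometry.angle z w := by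
  obtain ⟨hu0, hu1⟩ := unit_facts hd
  have he := tolerance_le (d := d) hb hε hε₁
  have h1 := hA.close z hz hθ
  have hθ0 : 0 < InnerProductGeometry.angle z w := by linarith
  have he' : 2 * ε₁ ≤ 1 / 2000 / d * InnerProductGeometry.angle z w :=
    he.trans (mul_le_mul_of_nonneg_left hθε hu0.le)
  have hprog : InnerProductGeometry.angle (candidate find z g) w ≤
      (1 - 1 / 25 / d) * InnerProductGeometry.angle z w := by
    refine angle_perturb_le_of_favourable hd hz hw hθ0 (hθ.trans hρ) (h1.trans ?_) hg hg'
    nlinarith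
  have h6 : 1 / 200 / (d : ℝ) = 10 * (1 / 2000 / d) := by ring
  have h7 : 1 / 25 / (d : ℝ) = 80 * (1 / 2000 / d) := by ring
  have h5 : 0.01 * estimateAngle find z / d = 20 * (1 / 2000 / d) * estimateAngle find z := by ring
  rw [h7] at hprog
  have hle : InnerProductGeometry.angle (candidate find z g) w ≤ InnerProductGeometry.angle z w :=
    hprog.trans (by nlinarith)
  have h2 := (abs_le.1 (hA.close _ (norm_candidate hz g) (hle.trans hθ))).2
  replace h1 := (abs_le.1 h1).1
  refine ⟨⟨⟨hA.pair z hz hθ, hA.pair _ (norm_candidate hz g) (hle.trans hθ)⟩, ?_⟩, ?_⟩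
  · rw [h5]
    set u : ℝ := 1 / 2000 / d
    set θ := InnerProductGeometry.angle z w
    set θ' := InnerProductGeometry.angle (candidate find z g) w
    have h9 : (1 - 2 * u) * θ * (1 - 20 * u) ≤ estimateAngle find z * (1 - 20 * u) :=
      mul_le_mul_of_nonneg_right (by linarith) (by linarith)
    have h10 : θ' * (1 + u) ≤ (1 - 80 * u) * θ * (1 + u) :=
      mul_le_mul_of_nonneg_right hprog (by linarith)
    have h12 : 0 < u * θ := mul_pos hu0 hθ0
    have h13 : 0 < u * (u * θ) := mul_pos hu0 h12
    nlinarith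
  · rw [h6]
    refine hprog.trans (mul_le_mul_of_nonneg_right (by linarith) hθ0.le)

lemma angle_candidate_le_add (hz : ‖z‖ = 1) : InnerProductGeometry.angle (candidate find z g) w ≤
    InnerProductGeometry.angle z w + 0.1 * (|estimateAngle find z| / d) * ‖g‖ := by
  have h1 := InnerProductGeometry.angle_le_angle_add_angle (candidate find z g) z w
  have h2 := angle_perturb_le hz (estimateAngle find z) g
  rw [InnerProductGeometry.angle_comm] at h2
  unfold candidate at h1 ⊢
  linarith

/-- The estimate is at most `2 (θ + b ε)` and the angle moved is at most `0.1 |α| ‖g‖ / d`, hence at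
most `0.4 ρ`. The permitted norm grows like `1 / (θ + b ε)`, which makes escapes rarer as the angle
shrinks. -/
lemma angle_candidate_le_radius (hA : IsAccurate f ε₁ find w ρ) (hd : 2 ≤ d) (hρ0 : 0 < ρ)
    (hb0 : 0 < b) (hε : 0 < ε) (hε₁ : ε₁ ≤ b * ε / d) (hz : ‖z‖ = 1)
    (hθ : InnerProductGeometry.angle z w ≤ ρ / 2)
    (hg : ‖g‖ ^ 2 ≤ (2 * ρ * d / (InnerProductGeometry.angle z w + b * ε)) ^ 2) :
    InnerProductGeometry.angle (candidate find z g) w ≤ ρ := by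
  obtain ⟨hu0, hu1⟩ := unit_facts hd
  have h0 := InnerProductGeometry.angle_nonneg z w
  have hd' : (2 : ℝ) ≤ d := by exact_mod_cast hd
  have h1 := abs_le.1 (hA.close z hz (by linarith))
  have hle := angle_candidate_le_add (find := find) (w := w) (g := g) hz
  set θ := InnerProductGeometry.angle z w
  have hbε : 0 < b * ε := mul_pos hb0 hε
  have he : 2 * ε₁ ≤ b * ε := by
    have : b * ε / d ≤ b * ε / 2 := by gcongr
    linarith
  have hm0 : 0 < θ + b * ε := by linarith
  have hα : |estimateAngle find z| ≤ 2 * (θ + b * ε) := by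
    rw [abs_le]; constructor <;> nlinarith
  have hg2 : ‖g‖ ≤ 2 * ρ * d / (θ + b * ε) :=
    (sq_le_sq₀ (norm_nonneg _) (by positivity)).1 hg
  have h3 : 0.1 * (|estimateAngle find z| / d) * ‖g‖ ≤
      0.1 * (2 * (θ + b * ε) / d) * (2 * ρ * d / (θ + b * ε)) := by gcongr
  have h4 : 0.1 * (2 * (θ + b * ε) / d) * (2 * ρ * d / (θ + b * ε)) = 0.4 * ρ := by
    have : (d : ℝ) ≠ 0 := by linarith
    field_simp; norm_num
  linarith

/-- An ordinary perturbation moves the vector by little more than half of `ε/4`, so the candidate is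
within about `1.51 · ε/4` and its estimate is still below `ε/2`. -/
lemma stops_of_norm_le (hA : IsAccurate f ε₁ find w ρ) (hd : 2 ≤ d)
    (hb : b ≤ 1 / 16000) (hε : 0 < ε) (hε₁0 : 0 < ε₁) (hε₁ : ε₁ ≤ b * ε / d) (hz : ‖z‖ = 1)
    (hθ : InnerProductGeometry.angle z w ≤ ρ)
    (hθ' : InnerProductGeometry.angle (candidate find z g) w ≤ ρ)
    (hθε : InnerProductGeometry.angle z w ≤ ε / 4) (hg : ‖g‖ ^ 2 ≤ 10 * d) :
    Stops f ε₁ (ε / 2) find z g := by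
  obtain ⟨hu0, hu1⟩ := unit_facts hd
  have he := tolerance_le (d := d) hb hε hε₁
  have h0 := InnerProductGeometry.angle_nonneg z w
  have hd' : (2 : ℝ) ≤ d := by exact_mod_cast hd
  have hle := angle_candidate_le_add (find := find) (w := w) (g := g) hz
  have h1 := abs_le.1 (hA.close z hz hθ)
  have h2 := (abs_le.1 (hA.close _ (norm_candidate hz g) hθ')).2
  refine ⟨⟨hA.pair z hz hθ, hA.pair _ (norm_candidate hz g) hθ'⟩, ?_⟩
  have hg2 : ‖g‖ ≤ 5 * d := by
    refine (sq_le_sq₀ (norm_nonneg _) (by positivity)).1 (hg.trans ?_)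
    nlinarith
  set u : ℝ := 1 / 2000 / d
  set θ := InnerProductGeometry.angle z w
  set θ' := InnerProductGeometry.angle (candidate find z g) w
  have huθ : u * θ ≤ 1 / 4000 * (ε / 4) := mul_le_mul hu1 hθε h0 (by norm_num)
  have huε : u * (ε / 4) ≤ 1 / 4000 * (ε / 4) := mul_le_mul_of_nonneg_right hu1 (by linarith)
  have hα : |estimateAngle find z| ≤ 1.001 * (ε / 4) := by
    rw [abs_le]; constructor <;> linarith
  have h3 : 0.1 * (|estimateAngle find z| / d) * ‖g‖ ≤
      0.1 * (1.001 * (ε / 4) / d) * (5 * d) := by gcongr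
  have h4 : 0.1 * (1.001 * (ε / 4) / d) * (5 * d) = 0.5005 * (ε / 4) := by
    have : (d : ℝ) ≠ 0 := by linarith
    field_simp; norm_num
  have h5 : θ' ≤ 1.51 * (ε / 4) := by linarith
  have h6 : u * θ' ≤ 1 / 4000 * (1.51 * (ε / 4)) :=
    mul_le_mul hu1 h5 (InnerProductGeometry.angle_nonneg _ _) (by norm_num)
  linarith

/-- On stopping, the candidate's estimate is at most `ε/2`. If the candidate is nevertheless
rejected, the estimate at `z` can exceed that of the candidate only by the small margin of the test,
so the vector kept is good too. -/
lemma angle_le_of_stops (hA : IsAccurate f ε₁ find w ρ) (hd : 2 ≤ d)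
    (hb : b ≤ 1 / 16000) (hε : 0 < ε) (hε₁ : ε₁ ≤ b * ε / d) (hz : ‖z‖ = 1)
    (hθ : InnerProductGeometry.angle z w ≤ ρ)
    (hθ' : InnerProductGeometry.angle (candidate find z g) w ≤ ρ)
    (hhalts : Stops f ε₁ (ε / 2) find z g) :
    InnerProductGeometry.angle (candidate find z g) w ≤ ε ∧
      (¬ Accepts f ε₁ find z g → InnerProductGeometry.angle z w ≤ ε) := by
  obtain ⟨hu0, hu1⟩ := unit_facts hd
  have he := tolerance_le (d := d) hb hε hε₁
  have h0 := InnerProductGeometry.angle_nonneg z w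
  have h0' := InnerProductGeometry.angle_nonneg (candidate find z g) w
  have h1 := (abs_le.1 (hA.close z hz hθ)).1
  have h2 := (abs_le.1 (hA.close _ (norm_candidate hz g) hθ')).1
  have huε : 1 / 2000 / d * (ε / 4) ≤ 1 / 4000 * (ε / 4) :=
    mul_le_mul_of_nonneg_right hu1 (by linarith)
  refine ⟨?_, fun hna => ?_⟩
  · have := mul_le_mul_of_nonneg_right hu1 h0'
    linarith [hhalts.2]
  · have h3 : estimateAngle find z - 0.01 * estimateAngle find z / d <
        estimateAngle find (candidate find z g) := by
      by_contra! h
      exact hna ⟨hhalts.1, h⟩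
    have h5 : 0.01 * estimateAngle find z / d = 20 * (1 / 2000 / d) * estimateAngle find z := by
      ring
    rw [h5] at h3
    have h4 := hhalts.2
    have h6 : estimateAngle find z ≤ 0.6 * ε := by
      by_contra! h
      nlinarith
    have := mul_le_mul_of_nonneg_right hu1 h0
    linarith

end Iteration

/-! ### Probabilities in one iteration -/

lemma exp_neg_two_mul_le (hd : 2 ≤ d) : Real.exp (-2 * d) ≤ 1 / 50 := by
  have hd' : (2 : ℝ) ≤ d := by exact_mod_cast hd
  have h1 : Real.exp (-2 * d) ≤ Real.exp (-4) := Real.exp_le_exp.2 (by linarith)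
  have h2 : (50 : ℝ) ≤ Real.exp 4 := by
    have h3 : Real.exp 4 = Real.exp 1 ^ 4 := by rw [← Real.exp_nat_mul]; norm_num
    rw [h3]
    calc (50 : ℝ) ≤ 2.7 ^ 4 := by norm_num
      _ ≤ _ := by gcongr; linarith [Real.exp_one_gt_d9]
  rw [Real.exp_neg] at h1
  refine h1.trans ?_
  rw [one_div]
  exact inv_anti₀ (by norm_num) h2

lemma stdGaussian_norm_sq_gt_le (hd : 2 ≤ d) :
    (stdGaussian (Vec d)).real {g | ¬ ‖g‖ ^ 2 ≤ 10 * d} ≤ 1 / 50 := by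
  refine (measureReal_mono fun g hg => ?_).trans
    ((stdGaussian_norm_sq_ge_le (10 * d)).trans (le_of_eq_of_le ?_ (exp_neg_two_mul_le hd)))
  · exact (not_le.1 hg).le
  · congr 1; ring

lemma stdGaussian_norm_sq_le_ge (hd : 2 ≤ d) :
    3 / 100 ≤ (stdGaussian (Vec d)).real {g | ‖g‖ ^ 2 ≤ 10 * d} := by
  have h1 : (stdGaussian (Vec d)).real Set.univ ≤ _ :=
    (measureReal_mono (fun g _ => (em (‖g‖ ^ 2 ≤ 10 * d)))).trans
      (measureReal_union_le {g : Vec d | ‖g‖ ^ 2 ≤ 10 * d} {g | ¬ ‖g‖ ^ 2 ≤ 10 * d})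
  rw [probReal_univ] at h1
  linarith [stdGaussian_norm_sq_gt_le hd]

/-- The tail beyond one standard deviation has mass at least `0.05`; removing the large norms costs
at most `0.02`. -/
lemma stdGaussian_favourable_ge (hd : 2 ≤ d) {v : Vec d} (hv : v ≠ 0) :
    3 / 100 ≤ (stdGaussian (Vec d)).real {g | ‖v‖ ≤ (inner ℝ v g : ℝ) ∧ ‖g‖ ^ 2 ≤ 10 * d} := by
  have hsub : {g : Vec d | ‖v‖ < (inner ℝ v g : ℝ)} ⊆
      {g | ‖v‖ ≤ (inner ℝ v g : ℝ) ∧ ‖g‖ ^ 2 ≤ 10 * d} ∪ {g | ¬ ‖g‖ ^ 2 ≤ 10 * d} := by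
    intro g hg
    by_cases h : ‖g‖ ^ 2 ≤ 10 * d
    · exact Or.inl ⟨le_of_lt hg, h⟩
    · exact Or.inr h
  have h1 := (measureReal_mono (μ := stdGaussian (Vec d)) hsub).trans (measureReal_union_le _ _)
  rw [stdGaussian_inner_gt hv, neg_div, div_self (norm_ne_zero_iff.2 hv), stdCdf_neg] at h1
  have h2 := le_stdCdf_two_sub_one
  have h3 : stdCdf 2 ≤ 1 := cdf_le_one _ _
  linarith [stdGaussian_norm_sq_gt_le hd]

/-- Since `m ≤ ρ²/100`, the tail exponent is at least `100 d²/m`. Half of it is spent through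
`e^{-x} ≤ 1/x` on the factor `m`, the rest on `e^{-d}` and the constant. Linearity in `m` is what
lets the escapes of a whole run be paid for by the decrease of the angle. -/
lemma exp_escape_le {ρ m : ℝ} (hd : 2 ≤ d) (hρ0 : 0 < ρ) (hρ : ρ ≤ 1 / 80) (hm0 : 0 < m)
    (hm : m ≤ ρ ^ 2 / 100) :
    Real.exp (d / 2 - (2 * ρ * d / m) ^ 2 / 4) ≤ Real.exp (-d) / (100000 * d) * m := by
  have hd' : (2 : ℝ) ≤ d := by exact_mod_cast hd
  have h1 : 100 * d ^ 2 / m ≤ (2 * ρ * d / m) ^ 2 / 4 := by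
    have : (2 * ρ * d / m) ^ 2 / 4 = ρ ^ 2 / m * (d ^ 2 / m) := by field_simp; ring
    rw [this, mul_div_assoc]
    gcongr
    rw [le_div_iff₀ hm0]; linarith
  have hm' : m ≤ 1 / 640000 := by nlinarith
  have h2 : (d : ℝ) ^ 2 * 640000 ≤ d ^ 2 / m := by
    rw [le_div_iff₀ hm0]
    nlinarith [sq_nonneg (d : ℝ)]
  have h3 : Real.exp (-(50 * d ^ 2 / m)) ≤ m / (50 * d ^ 2) := by
    rw [Real.exp_neg, ← inv_div (50 * (d : ℝ) ^ 2) m]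
    apply inv_anti₀ (by positivity)
    linarith [Real.add_one_le_exp (50 * d ^ 2 / m)]
  have h4 : Real.exp (-12) ≤ 1 / 100000 := by
    rw [Real.exp_neg, one_div]
    apply inv_anti₀ (by norm_num)
    have : Real.exp 12 = Real.exp 1 ^ 12 := by rw [← Real.exp_nat_mul]; norm_num
    rw [this]
    calc (100000 : ℝ) ≤ 2.7 ^ 12 := by norm_num
      _ ≤ _ := by gcongr; linarith [Real.exp_one_gt_d9]
  calc _ ≤ Real.exp (-(50 * d ^ 2 / m) + (-d + -12)) := by
        apply Real.exp_le_exp.2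
        have h5 : 100 * (d : ℝ) ^ 2 / m = 2 * (50 * d ^ 2 / m) := by ring
        have h6 : 50 * (d : ℝ) ^ 2 / m = 50 * (d ^ 2 / m) := by ring
        nlinarith
    _ = Real.exp (-(50 * d ^ 2 / m)) * (Real.exp (-d) * Real.exp (-12)) := by
        rw [Real.exp_add, Real.exp_add]
    _ ≤ m / (50 * d ^ 2) * (Real.exp (-d) * (1 / 100000)) := by gcongr
    _ ≤ m / d * (Real.exp (-d) * (1 / 100000)) := by
        gcongr; nlinarith
    _ = _ := by field_simp

section Iteration

variable {f : Vec d → ℝ} {ε ε₁ ρ b : ℝ} {find : Vec d → ℝ × ℝ} {z w : Vec d}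

/-- The probability of a perturbation so large that the candidate may leave the region in which
the angle estimate is accurate. -/
lemma stdGaussian_escape_le (hd : 2 ≤ d) (hρ0 : 0 < ρ) (hρ : ρ ≤ 1 / 80) (hb0 : 0 < b)
    (hb : b ≤ ρ ^ 2 / 200) (hε : 0 < ε) (hε1 : ε ≤ 1)
    (hθ : InnerProductGeometry.angle z w ≤ ρ ^ 2 / 200) :
    (stdGaussian (Vec d)).real
      {g | ¬ ‖g‖ ^ 2 ≤ (2 * ρ * d / (InnerProductGeometry.angle z w + b * ε)) ^ 2} ≤
      Real.exp (-d) / (100000 * d) * (InnerProductGeometry.angle z w + b * ε) := by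
  have h0 := InnerProductGeometry.angle_nonneg z w
  refine (measureReal_mono fun g hg => ?_).trans ((stdGaussian_norm_sq_ge_le
    ((2 * ρ * d / (InnerProductGeometry.angle z w + b * ε)) ^ 2)).trans
    (exp_escape_le hd hρ0 hρ (by positivity) ?_))
  · exact (not_le.1 hg).le
  · nlinarith

lemma favourable_probability (hA : IsAccurate f ε₁ find w ρ) (hd : 2 ≤ d) (hρ : ρ ≤ 1 / 80)
    (hb : b ≤ 1 / 16000) (hε : 0 < ε) (hε₁ : ε₁ ≤ b * ε / d) (hz : ‖z‖ = 1) (hw : ‖w‖ = 1)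
    (hθ : InnerProductGeometry.angle z w ≤ ρ)
    (hθε : ε / 4 ≤ InnerProductGeometry.angle z w) :
    3 / 100 ≤ (stdGaussian (Vec d)).real {g | Accepts f ε₁ find z g ∧
      InnerProductGeometry.angle (candidate find z g) w ≤
        (1 - 1 / 200 / d) * InnerProductGeometry.angle z w} := by
  have hv : orthoPart z w ≠ 0 := by
    rw [← norm_pos_iff, norm_orthoPart hz hw]
    exact Real.sin_pos_of_pos_of_lt_pi (by linarith) (by linarith [Real.pi_gt_three])
  refine (stdGaussian_favourable_ge hd hv).trans (measureReal_mono fun g hg => ?_)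
  rw [norm_orthoPart hz hw] at hg
  exact accepts_of_favourable hA hd hρ hb hε hε₁ hz hw hθ hθε hg.2 hg.1

/-- Without an escape both estimates are accurate, and then acceptance implies the decrease; so the
event lies in the escape event. -/
lemma misleading_probability (hA : IsAccurate f ε₁ find w ρ) (hd : 2 ≤ d) (hρ0 : 0 < ρ)
    (hρ : ρ ≤ 1 / 80) (hb0 : 0 < b) (hb : b ≤ ρ ^ 2 / 200) (hε : 0 < ε) (hε1 : ε ≤ 1)
    (hε₁ : ε₁ ≤ b * ε / d) (hz : ‖z‖ = 1)
    (hθ : InnerProductGeometry.angle z w ≤ ρ ^ 2 / 200)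
    (hθε : ε / 4 ≤ InnerProductGeometry.angle z w) :
    (stdGaussian (Vec d)).real {g | Accepts f ε₁ find z g ∧
      ¬ InnerProductGeometry.angle (candidate find z g) w ≤
        (1 - 1 / 200 / d) * InnerProductGeometry.angle z w} ≤ Real.exp (-d) := by
  have hd' : (2 : ℝ) ≤ d := by exact_mod_cast hd
  have hρθ : ρ ^ 2 / 200 ≤ ρ / 2 := by nlinarith
  refine (measureReal_mono fun g hg => ?_).trans
    ((stdGaussian_escape_le hd hρ0 hρ hb0 hb hε hε1 hθ).trans ?_)
  · intro hg'
    have h1 := angle_candidate_le_radius hA hd hρ0 hb0 hε hε₁ hz (hθ.trans hρθ) hg'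
    have h2 := angle_candidate_le_of_accepts hA hd (by nlinarith) hε hε₁ hz (by linarith) h1 hg.1
    rw [max_eq_left hθε] at h2
    exact hg.2 h2
  · have h0 := InnerProductGeometry.angle_nonneg z w
    have h1 : InnerProductGeometry.angle z w + b * ε ≤ 1 := by nlinarith
    have h2 : Real.exp (-d) / (100000 * d) ≤ Real.exp (-d) :=
      div_le_self (Real.exp_pos _).le (by linarith)
    have h3 : 0 ≤ Real.exp (-d) / (100000 * d) := by positivity
    nlinarith

end Iteration

/-! ### Measurability -/

section Measurability

variable {f : Vec d → ℝ} {ε ε₁ ε₂ : ℝ} {find : Vec d → ℝ × ℝ}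

lemma measurable_estimateAngle (hfind : Measurable find) : Measurable (estimateAngle find) := by
  unfold estimateAngle estimateTanAlpha
  fun_prop

lemma measurable_candidate (hfind : Measurable find) :
    Measurable fun p : Vec d × Vec d => candidate find p.1 p.2 := by
  have := measurable_estimateAngle hfind
  unfold candidate perturb
  fun_prop

lemma measurable_bandProb (hF : MeasurableSet {x | sgn (f x) = 1}) :
    Measurable fun p : Vec d × ℝ => bandProb f ε p.1 p.2 := by
  have hband : MeasurableSet
      {q : (Vec d × ℝ) × Vec d | (inner ℝ q.1.1 q.2 : ℝ) ∈ Set.Icc (q.1.2 - ε) q.1.2} := by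
    have h1 : Measurable fun q : (Vec d × ℝ) × Vec d => (inner ℝ q.1.1 q.2 : ℝ) := by fun_prop
    exact (measurableSet_le (by fun_prop) h1).inter (measurableSet_le h1 (by fun_prop))
  simp_rw [bandProb_eq]
  refine Measurable.div ?_ ?_
  · exact (measurable_measure_prodMk_left (ν := stdGaussian (Vec d))
      (hband.inter (measurable_snd hF))).ennreal_toReal
  · exact (measurable_measure_prodMk_left (ν := stdGaussian (Vec d)) hband).ennreal_toReal

lemma measurableSet_isThresholdPair (hF : MeasurableSet {x | sgn (f x) = 1})
    (hfind : Measurable find) : MeasurableSet {z | IsThresholdPair f ε z (find z)} := by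
  have hb := measurable_bandProb (ε := ε) hF
  have h1 : Measurable fun z => bandProb f ε z (find z).1 := by
    have h : Measurable fun z => (z, (find z).1) := by fun_prop
    simpa only [Function.comp_def] using hb.comp h
  have h2 : Measurable fun z => bandProb f ε z (find z).2 := by
    have h : Measurable fun z => (z, (find z).2) := by fun_prop
    simpa only [Function.comp_def] using hb.comp h
  have h3 : MeasurableSet {z | 0 ≤ (find z).1} :=
    measurableSet_le measurable_const (measurable_fst.comp hfind)
  have h4 : MeasurableSet {z | 0 ≤ (find z).2} :=
    measurableSet_le measurable_const (measurable_snd.comp hfind)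
  have h5 : MeasurableSet {z | bandProb f ε z (find z).1 = 0.4} :=
    measurableSet_eq_fun h1 measurable_const
  have h6 : MeasurableSet {z | bandProb f ε z (find z).2 = 0.6} :=
    measurableSet_eq_fun h2 measurable_const
  have : {z | IsThresholdPair f ε z (find z)} = {z | 0 ≤ (find z).1} ∩ ({z | 0 ≤ (find z).2} ∩
      ({z | bandProb f ε z (find z).1 = 0.4} ∩ {z | bandProb f ε z (find z).2 = 0.6})) := by
    ext z
    simp only [Set.mem_ofPred_eq, Set.mem_inter_iff, IsThresholdPair]
  rw [this]
  exact h3.inter (h4.inter (h5.inter h6))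

lemma measurableSet_estimatesExist (hF : MeasurableSet {x | sgn (f x) = 1})
    (hfind : Measurable find) :
    MeasurableSet {p : Vec d × Vec d | EstimatesExist f ε₁ find p.1 p.2} := by
  have h := measurableSet_isThresholdPair (ε := ε₁) hF hfind
  exact (measurable_fst h).inter (measurable_candidate hfind h)

lemma measurableSet_accepts (hF : MeasurableSet {x | sgn (f x) = 1}) (hfind : Measurable find) :
    MeasurableSet {p : Vec d × Vec d | Accepts f ε₁ find p.1 p.2} := by
  have h1 := measurable_estimateAngle hfind
  have h2 := measurable_candidate hfind
  refine (measurableSet_estimatesExist hF hfind).inter (measurableSet_le (h1.comp h2) ?_)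
  fun_prop

lemma measurableSet_stops (hF : MeasurableSet {x | sgn (f x) = 1}) (hfind : Measurable find) :
    MeasurableSet {p : Vec d × Vec d | Stops f ε₁ ε₂ find p.1 p.2} :=
  (measurableSet_estimatesExist hF hfind).inter (measurableSet_le
    ((measurable_estimateAngle hfind).comp (measurable_candidate hfind)) measurable_const)

lemma measurable_refineStep (hF : MeasurableSet {x | sgn (f x) = 1}) (hfind : Measurable find) :
    Measurable fun p : (Vec d × Bool) × Vec d => refineStep f ε₁ ε₂ find p.1 p.2 := by
  classical
  have hpair : Measurable fun p : (Vec d × Bool) × Vec d => (p.1.1, p.2) := by fun_prop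
  have hhalts : MeasurableSet {p : (Vec d × Bool) × Vec d | p.1.2 = true} :=
    (measurable_snd.comp measurable_fst) (measurableSet_singleton true)
  have hacc : MeasurableSet {p : (Vec d × Bool) × Vec d | Accepts f ε₁ find p.1.1 p.2} :=
    hpair (measurableSet_accepts hF hfind)
  have hst : MeasurableSet {p : (Vec d × Bool) × Vec d | Stops f ε₁ ε₂ find p.1.1 p.2} :=
    hpair (measurableSet_stops hF hfind)
  have hcand : Measurable fun p : (Vec d × Bool) × Vec d => candidate find p.1.1 p.2 := by
    simpa only [Function.comp_def] using (measurable_candidate hfind).comp hpair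
  have hnew : Measurable fun p : (Vec d × Bool) × Vec d =>
      if Accepts f ε₁ find p.1.1 p.2 then candidate find p.1.1 p.2 else p.1.1 :=
    Measurable.ite hacc hcand (measurable_fst.comp measurable_fst)
  have hflag : Measurable fun p : (Vec d × Bool) × Vec d =>
      if Stops f ε₁ ε₂ find p.1.1 p.2 then true else false :=
    Measurable.ite hst measurable_const measurable_const
  have heq : (fun p : (Vec d × Bool) × Vec d => refineStep f ε₁ ε₂ find p.1 p.2) =
      fun p => if p.1.2 = true then p.1 else
        (if Accepts f ε₁ find p.1.1 p.2 then candidate find p.1.1 p.2 else p.1.1,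
          if Stops f ε₁ ε₂ find p.1.1 p.2 then true else false) := by
    funext p
    unfold refineStep
    split_ifs <;> simp_all
  rw [heq]
  exact Measurable.ite hhalts measurable_fst (hnew.prodMk hflag)

end Measurability

/-! ### Supermartingale bound for a driven recursion -/

section Recursion

variable {S E : Type*} [MeasurableSpace S] [MeasurableSpace E] {γ : Measure E}
  [IsProbabilityMeasure γ] {step : S → E → S} {state : (ℕ → E) → ℕ → S} {s₀ : S}

/-- The state at time `n` depends only on the samples with index below `n`; this is what makes it
independent of sample `n`. -/
lemma measurable_recursion (hstep : Measurable fun p : S × E => step p.1 p.2)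
    (h0 : ∀ g, state g 0 = s₀) (hs : ∀ g n, state g (n + 1) = step (state g n) (g n)) (n : ℕ) :
    Measurable[⨆ k ∈ Set.Iio n, MeasurableSpace.comap (fun g : ℕ → E => g k) inferInstance]
      fun g => state g n := by
  induction n with
  | zero => simp_rw [h0]; exact measurable_const
  | succ n ih =>
    simp_rw [hs]
    have hle : (⨆ k ∈ Set.Iio n, MeasurableSpace.comap (fun g : ℕ → E => g k) inferInstance) ≤
        ⨆ k ∈ Set.Iio (n + 1), MeasurableSpace.comap (fun g : ℕ → E => g k) inferInstance :=
      biSup_mono fun k (hk : k < n) => hk.trans (Nat.lt_succ_self n)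
    have hn : Measurable[⨆ k ∈ Set.Iio (n + 1),
        MeasurableSpace.comap (fun g : ℕ → E => g k) inferInstance] fun g : ℕ → E => g n :=
      (comap_measurable _).mono (le_biSup (fun k => MeasurableSpace.comap (fun g : ℕ → E => g k)
        inferInstance) (Set.mem_Iio.2 (Nat.lt_succ_self n))) le_rfl
    exact hstep.comp ((ih.mono hle le_rfl).prodMk hn)

lemma measurable_recursion' (hstep : Measurable fun p : S × E => step p.1 p.2)
    (h0 : ∀ g, state g 0 = s₀) (hs : ∀ g n, state g (n + 1) = step (state g n) (g n)) (n : ℕ) :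
    Measurable fun g => state g n :=
  (measurable_recursion hstep h0 hs n).mono
    (iSup₂_le fun k _ => (measurable_pi_apply k).comap_le) le_rfl

lemma indepFun_recursion (hstep : Measurable fun p : S × E => step p.1 p.2)
    (h0 : ∀ g, state g 0 = s₀) (hs : ∀ g n, state g (n + 1) = step (state g n) (g n)) (n : ℕ) :
    IndepFun (fun g => state g n) (fun g : ℕ → E => g n) (Measure.infinitePi fun _ : ℕ => γ) := by
  have hind : iIndepFun (fun (k : ℕ) (g : ℕ → E) => g k) (Measure.infinitePi fun _ : ℕ => γ) :=
    iIndepFun_infinitePi (X := fun _ => id) fun _ => measurable_id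
  have h := indep_iSup_of_disjoint (fun k => (measurable_pi_apply k).comap_le) hind.iIndep
    (S := Set.Iio n) (T := {n}) (by simp)
  rw [iSup_singleton] at h
  exact indep_of_indep_of_le_left h (measurable_recursion hstep h0 hs n).comap_le

/-- Integrating out the fresh sample first, which is independent of the current state, turns the
one-step inequality into a bound for the whole run. -/
lemma lintegral_recursion_le (hstep : Measurable fun p : S × E => step p.1 p.2)
    (h0 : ∀ g, state g 0 = s₀) (hs : ∀ g n, state g (n + 1) = step (state g n) (g n))
    {ψ : ℕ → S → ENNReal} (hψ : ∀ n, Measurable (ψ n))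
    (hle : ∀ n s, ∫⁻ x, ψ (n + 1) (step s x) ∂γ ≤ ψ n s) (n : ℕ) :
    ∫⁻ g, ψ n (state g n) ∂(Measure.infinitePi fun _ : ℕ => γ) ≤ ψ 0 s₀ := by
  induction n with
  | zero => simp [h0]
  | succ n ih =>
    refine le_trans ?_ ih
    have hm := measurable_recursion' hstep h0 hs n
    have hprod := (indepFun_iff_map_prod_eq_prod_map_map hm.aemeasurable
      (measurable_pi_apply n).aemeasurable).1 (indepFun_recursion (γ := γ) hstep h0 hs n)
    rw [Measure.infinitePi_map_eval] at hprod
    have hF : Measurable fun p : S × E => ψ (n + 1) (step p.1 p.2) := (hψ (n + 1)).comp hstep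
    have hpm : Measurable fun g : ℕ → E => (state g n, g n) := hm.prodMk (measurable_pi_apply n)
    calc ∫⁻ g, ψ (n + 1) (state g (n + 1)) ∂(Measure.infinitePi fun _ : ℕ => γ)
        = ∫⁻ p, ψ (n + 1) (step p.1 p.2)
            ∂((Measure.infinitePi fun _ : ℕ => γ).map fun g => (state g n, g n)) := by
          rw [lintegral_map hF hpm]; simp_rw [hs]
      _ = ∫⁻ s, ∫⁻ x, ψ (n + 1) (step s x) ∂γ
            ∂((Measure.infinitePi fun _ : ℕ => γ).map fun g => state g n) := by
          rw [hprod, lintegral_prod _ hF.aemeasurable]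
      _ ≤ ∫⁻ s, ψ n s ∂((Measure.infinitePi fun _ : ℕ => γ).map fun g => state g n) :=
          lintegral_mono fun s => hle n s
      _ = _ := lintegral_map (hψ n) hm

end Recursion

/-! ### The potential -/

/-- Bound for the probability that RefineEstimate fails, as a function of the number `n` of
iterations done and the current angle `θ`. -/
noncomputable def potential (d : ℕ) (ε G : ℝ) (N n : ℕ) (θ : ℝ) : ℝ :=
  Real.exp (-d) / 4 * (ε + if ε / 4 ≤ θ then θ else 0) +
    if θ ≤ G then 0 else (θ / G) ^ (200 * d) * (197 / 200) ^ N * (200 / 197) ^ n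

/-- Charges 1 on the bad set, `x₁` on the favourable set and `x₀` elsewhere. The two sets may
overlap, since the bound on `F` holds throughout `F`. -/
lemma lintegral_le_of_favourable {Ω : Type*} [MeasurableSpace Ω] {μ : Measure Ω}
    [IsProbabilityMeasure μ] {φ : Ω → ENNReal} {B F : Set Ω} {β p x₀ x₁ : ℝ}
    (hB : MeasurableSet B) (hF : MeasurableSet F) (hφ : ∀ g, φ g ≤ 1) (hβ : μ.real B ≤ β)
    (hp : p ≤ μ.real F) (h1 : 0 ≤ x₁) (h01 : x₁ ≤ x₀)
    (hx₀ : ∀ g, g ∉ B → φ g ≤ ENNReal.ofReal x₀) (hx₁ : ∀ g ∈ F, φ g ≤ ENNReal.ofReal x₁) :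
    ∫⁻ g, φ g ∂μ ≤ ENNReal.ofReal (β + (1 - p) * x₀ + p * x₁) := by
  have hpt : ∀ g, φ g ≤ B.indicator (fun _ => 1) g + (F.indicator (fun _ => ENNReal.ofReal x₁) g +
      Fᶜ.indicator (fun _ => ENNReal.ofReal x₀) g) := by
    intro g
    by_cases hgF : g ∈ F
    · refine (hx₁ g hgF).trans ?_
      rw [Set.indicator_of_mem hgF]
      exact le_add_left le_self_add
    · by_cases hgB : g ∈ B
      · rw [Set.indicator_of_mem hgB]
        exact (hφ g).trans le_self_add
      · refine (hx₀ g hgB).trans ?_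
        rw [Set.indicator_of_mem (show g ∈ Fᶜ from hgF)]
        exact le_add_left le_add_self
  refine (lintegral_mono hpt).trans ?_
  rw [lintegral_add_left (measurable_const.indicator hB),
    lintegral_add_left (measurable_const.indicator hF), lintegral_indicator_const hB,
    lintegral_indicator_const hF, lintegral_indicator_const hF.compl, one_mul,
    ← ofReal_measureReal, ← ofReal_measureReal (s := F), ← ofReal_measureReal (s := Fᶜ),
    ← ENNReal.ofReal_mul h1, ← ENNReal.ofReal_mul (h1.trans h01),
    ← ENNReal.ofReal_add (by positivity) (mul_nonneg (h1.trans h01) measureReal_nonneg),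
    ← ENNReal.ofReal_add measureReal_nonneg
      (add_nonneg (by positivity) (mul_nonneg (h1.trans h01) measureReal_nonneg))]
  apply ENNReal.ofReal_le_ofReal
  rw [measureReal_compl hF, probReal_univ]
  nlinarith

/-- Explains the exponent `200 d` in the potential: one guaranteed contraction halves the power, and
`97/100 + (3/100)/2 = 197/200` is the resulting decay rate. -/
lemma one_sub_inv_pow_le_half (hd : 2 ≤ d) : (1 - 1 / 200 / (d : ℝ)) ^ (200 * d) ≤ 1 / 2 := by
  have hd' : (2 : ℝ) ≤ d := by exact_mod_cast hd
  have h1 : 1 - 1 / 200 / (d : ℝ) ≤ Real.exp (-(1 / 200 / d)) := by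
    linarith [Real.add_one_le_exp (-(1 / 200 / (d : ℝ)))]
  have h2 : 1 / 200 / (d : ℝ) ≤ 1 := by rw [div_le_one (by linarith)]; linarith
  calc _ ≤ Real.exp (-(1 / 200 / d)) ^ (200 * d) := pow_le_pow_left₀ (by linarith) h1 _
    _ = Real.exp (-1) := by
      rw [← Real.exp_nat_mul]; congr 1; push_cast; field_simp
    _ ≤ 1 / 2 := by
      rw [Real.exp_neg, one_div]
      exact inv_anti₀ (by norm_num) (by linarith [Real.add_one_le_exp (1 : ℝ)])

lemma exp_le_one_sub_inv_pow (hd : 2 ≤ d) :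
    Real.exp (-2) ≤ (1 - 1 / 200 / (d : ℝ)) ^ (200 * d) := by
  have hd' : (2 : ℝ) ≤ d := by exact_mod_cast hd
  set x : ℝ := 1 / 200 / (d : ℝ) with hx
  have hx0 : 0 < x := by positivity
  have hx1 : x ≤ 1 / 2 := by rw [hx, div_le_iff₀ (by linarith)]; linarith
  have h1 : Real.exp (-(2 * x)) ≤ 1 - x := by
    rw [Real.exp_neg, inv_le_comm₀ (Real.exp_pos _) (by linarith)]
    have h2 := Real.add_one_le_exp (2 * x)
    refine le_trans ?_ h2
    rw [inv_le_iff_one_le_mul₀ (by linarith)]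
    nlinarith
  calc Real.exp (-2) = Real.exp (-(2 * x)) ^ (200 * d) := by
        rw [← Real.exp_nat_mul]; congr 1; rw [hx]; push_cast; field_simp
    _ ≤ _ := pow_le_pow_left₀ (Real.exp_pos _).le h1 _

section Potential

variable {ε G θ θ' : ℝ} {N n : ℕ}

lemma potential_nonneg (hε : 0 < ε) (hG : ε ≤ G) (hθ : 0 ≤ θ) : 0 ≤ potential d ε G N n θ := by
  unfold potential
  have hG0 : 0 < G := hε.trans_le hG
  split_ifs <;> positivity

lemma potential_mono (hε : 0 < ε) (hG : ε ≤ G) (hθ : 0 ≤ θ) (h : θ ≤ θ') :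
    potential d ε G N n θ ≤ potential d ε G N n θ' := by
  have hG0 : 0 < G := hε.trans_le hG
  have hθ' : 0 ≤ θ' := hθ.trans h
  unfold potential
  refine add_le_add ?_ ?_
  · gcongr
    split_ifs <;> linarith
  · split_ifs
    · rfl
    · positivity
    · linarith
    · gcongr

lemma potential_low (hG : ε ≤ G) (hε : 0 < ε) (h : θ < ε / 4) :
    potential d ε G N n θ = Real.exp (-d) / 4 * ε := by
  unfold potential
  rw [if_neg (not_le.2 h), if_pos (by linarith)]
  ring

/-- Below `ε/4` the potential no longer depends on the angle; the escape probability is paid by the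
stopping probability `3/100` acting on the term `ε`. -/
lemma potential_step_low (hε : 0 < ε) (hd : 2 ≤ d) {β : ℝ}
    (hβ : β ≤ Real.exp (-d) / (100000 * d) * ε) :
    β + (1 - 3 / 100) * (Real.exp (-d) / 4 * ε) + 3 / 100 * 0 ≤ Real.exp (-d) / 4 * ε := by
  have hd' : (2 : ℝ) ≤ d := by exact_mod_cast hd
  have h1 : Real.exp (-d) / (100000 * d) ≤ Real.exp (-d) / 100000 := by
    apply div_le_div_of_nonneg_left (Real.exp_pos _).le (by norm_num); linarith
  have h2 := mul_le_mul_of_nonneg_right h1 hε.le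
  have h3 : 0 < Real.exp (-d) * ε := by positivity
  linarith

/-- The two terms balance separately. A contraction with probability `3/100` lowers the linear term
in mean by `3/(80000 d) · e^{-d} θ`, more than the escape bound `2/(100000 d) · e^{-d} θ`; the power
term loses the factor `197/200`, which the increase of `n` restores. -/
lemma potential_step_high (hε : 0 < ε) (hG : ε ≤ G) (hd : 2 ≤ d) (hθ : ε / 4 ≤ θ) {β : ℝ}
    (hβ : β ≤ Real.exp (-d) / (100000 * d) * (2 * θ)) :
    β + (1 - 3 / 100) * potential d ε G N (n + 1) θ +
      3 / 100 * potential d ε G N (n + 1) ((1 - 1 / 200 / d) * θ) ≤ potential d ε G N n θ := by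
  have hd' : (2 : ℝ) ≤ d := by exact_mod_cast hd
  have hG0 : 0 < G := hε.trans_le hG
  have hθ0 : 0 < θ := by linarith
  have hx0 : 0 < 1 / 200 / (d : ℝ) := by positivity
  have hx1 : 1 / 200 / (d : ℝ) ≤ 1 := by rw [div_le_one (by linarith)]; linarith
  have hle : (1 - 1 / 200 / d) * θ ≤ θ := by nlinarith
  unfold potential
  rw [if_pos hθ]
  have hV : (if ε / 4 ≤ (1 - 1 / 200 / (d : ℝ)) * θ then (1 - 1 / 200 / (d : ℝ)) * θ else 0) ≤
      (1 - 1 / 200 / d) * θ := by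
    split_ifs
    · rfl
    · exact mul_nonneg (by linarith) hθ0.le
  have hU : (1 - 3 / 100) * (if θ ≤ G then 0 else
        (θ / G) ^ (200 * d) * (197 / 200 : ℝ) ^ N * (200 / 197 : ℝ) ^ (n + 1)) +
      3 / 100 * (if (1 - 1 / 200 / (d : ℝ)) * θ ≤ G then 0 else
        ((1 - 1 / 200 / d) * θ / G) ^ (200 * d) * (197 / 200 : ℝ) ^ N * (200 / 197) ^ (n + 1)) ≤
      if θ ≤ G then 0 else (θ / G) ^ (200 * d) * (197 / 200 : ℝ) ^ N * (200 / 197) ^ n := by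
    by_cases h : θ ≤ G
    · rw [if_pos h, if_pos (hle.trans h), if_pos h]; norm_num
    · rw [if_neg h, if_neg h]
      set u := (θ / G) ^ (200 * d) * (197 / 200 : ℝ) ^ N * (200 / 197) ^ n with hu
      have hu0 : 0 ≤ u := by positivity
      have h1 : (θ / G) ^ (200 * d) * (197 / 200 : ℝ) ^ N * (200 / 197) ^ (n + 1) =
          200 / 197 * u := by rw [hu]; ring
      have h2 : (if (1 - 1 / 200 / (d : ℝ)) * θ ≤ G then 0 else
          ((1 - 1 / 200 / d) * θ / G) ^ (200 * d) * (197 / 200 : ℝ) ^ N * (200 / 197) ^ (n + 1)) ≤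
          1 / 2 * (200 / 197 * u) := by
        split_ifs
        · positivity
        · rw [mul_div_assoc, mul_pow, mul_assoc, mul_assoc, ← mul_assoc ((θ / G) ^ (200 * d)), h1]
          exact mul_le_mul_of_nonneg_right (one_sub_inv_pow_le_half hd) (by positivity)
      rw [h1]
      linarith
  have hE : 0 < Real.exp (-(d : ℝ)) := Real.exp_pos _
  have h3 : Real.exp (-(d : ℝ)) / 4 * (ε + if ε / 4 ≤ (1 - 1 / 200 / (d : ℝ)) * θ then
      (1 - 1 / 200 / (d : ℝ)) * θ else 0) ≤
      Real.exp (-(d : ℝ)) / 4 * (ε + (1 - 1 / 200 / d) * θ) := by gcongr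
  have h4 : Real.exp (-(d : ℝ)) / (100000 * d) * (2 * θ) =
      1 / 250 * (Real.exp (-(d : ℝ)) * θ * (1 / 200 / d)) := by field_simp; norm_num
  have h5 : 0 < Real.exp (-(d : ℝ)) * θ * (1 / 200 / d) := by positivity
  nlinarith

end Potential

/-! ### Failure probability of RefineEstimate -/

section Failure

variable {f : Vec d → ℝ} {ε ε₁ ρ b G : ℝ} {find : Vec d → ℝ × ℝ} {z w g : Vec d} {N : ℕ}

/-- The state after an iteration whose perturbation is not exceptionally large. -/
lemma refineStep_spec (hA : IsAccurate f ε₁ find w ρ) (hd : 2 ≤ d) (hρ0 : 0 < ρ)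
    (hρ : ρ ≤ 1 / 80) (hb0 : 0 < b) (hb : b ≤ ρ ^ 2 / 1000000) (hε : 0 < ε) (hε1 : ε ≤ 1)
    (hε₁ : ε₁ ≤ b * ε / d) (hz : ‖z‖ = 1)
    (hθ : InnerProductGeometry.angle z w ≤ ρ ^ 2 / 200)
    (hg : InnerProductGeometry.angle (candidate find z g) w ≤ ρ) :
    ‖(refineStep f ε₁ (ε / 2) find (z, false) g).1‖ = 1 ∧
    ((refineStep f ε₁ (ε / 2) find (z, false) g).2 = true →
      InnerProductGeometry.angle (refineStep f ε₁ (ε / 2) find (z, false) g).1 w ≤ ε) ∧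
    ((refineStep f ε₁ (ε / 2) find (z, false) g).1 = z ∨
      InnerProductGeometry.angle (refineStep f ε₁ (ε / 2) find (z, false) g).1 w ≤
        (1 - 1 / 200 / d) * max (InnerProductGeometry.angle z w) (min (ε / 4) (ρ ^ 2 / 200))) := by
  have hθρ : InnerProductGeometry.angle z w ≤ ρ := hθ.trans (by nlinarith)
  have hb' : b ≤ 1 / 16000 := by nlinarith
  have hhalts := angle_le_of_stops (g := g) hA hd hb' hε hε₁ hz hθρ hg
  unfold refineStep
  simp only [Bool.false_eq_true, if_false, decide_eq_true_eq]
  by_cases hacc : Accepts f ε₁ find z g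
  · rw [if_pos hacc]
    refine ⟨norm_candidate hz g, fun h => (hhalts h).1, Or.inr ?_⟩
    have hm : (0 : ℝ) < min (ε / 4) (ρ ^ 2 / 200) := lt_min (by linarith) (by positivity)
    -- The lemma is applied with `4 · min (ε/4) (ρ²/200)` in place of `ε`: `ε/4` may exceed
    -- `ρ²/200`, and the new vector must stay in the region of that radius. The small `b` keeps `ε₁`
    -- admissible for the reduced value.
    have h := angle_candidate_le_of_accepts (ε := 4 * min (ε / 4) (ρ ^ 2 / 200)) (b := 1 / 16000)
      hA hd le_rfl (by linarith) (hε₁.trans ?_) hz hθρ hg hacc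
    · rwa [mul_div_cancel_left₀ _ (by norm_num)] at h
    · have hmin : 4000 * (b * ε) ≤ min (ε / 4) (ρ ^ 2 / 200) := le_min (by nlinarith) (by nlinarith)
      exact div_le_div_of_nonneg_right (by linarith) (Nat.cast_nonneg d)
  · rw [if_neg hacc]
    exact ⟨hz, fun h => (hhalts h).2 hacc, Or.inl rfl⟩

open Classical in
/-- The potential of a state of RefineEstimate. -/
noncomputable def statePotential (ε ρ G : ℝ) (w : Vec d) (N n : ℕ) (s : Vec d × Bool) : ENNReal :=
  if s.2 = true then
    if ‖s.1‖ = 1 ∧ InnerProductGeometry.angle s.1 w ≤ G then 0 else 1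
  else if ‖s.1‖ = 1 ∧ InnerProductGeometry.angle s.1 w ≤ ρ ^ 2 / 200 then
    min 1 (ENNReal.ofReal (potential d ε G N n (InnerProductGeometry.angle s.1 w)))
  else 1

lemma statePotential_le_one (n : ℕ) (s : Vec d × Bool) :
    statePotential ε ρ G w N n s ≤ 1 := by
  unfold statePotential
  split_ifs
  · exact zero_le_one
  · rfl
  · exact min_le_left _ _
  · rfl

lemma measurable_angle_left (w : Vec d) :
    Measurable fun z : Vec d => InnerProductGeometry.angle z w := by
  unfold InnerProductGeometry.angle
  exact Real.measurable_arccos.comp (by fun_prop)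

lemma measurable_potential (n : ℕ) : Measurable (potential d ε G N n) := by
  unfold potential
  refine Measurable.add (Measurable.const_mul (Measurable.const_add (Measurable.ite
    measurableSet_Ici measurable_id measurable_const) _) _)
    (Measurable.ite measurableSet_Iic measurable_const (by fun_prop))

lemma measurableSet_good (G : ℝ) (w : Vec d) :
    MeasurableSet {s : Vec d × Bool | ‖s.1‖ = 1 ∧ InnerProductGeometry.angle s.1 w ≤ G} := by
  have h1 : MeasurableSet {s : Vec d × Bool | ‖s.1‖ = 1} :=
    measurableSet_eq_fun (by fun_prop) measurable_const
  have h2 : MeasurableSet {s : Vec d × Bool | InnerProductGeometry.angle s.1 w ≤ G} :=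
    measurableSet_le ((measurable_angle_left w).comp measurable_fst) measurable_const
  exact h1.inter h2

lemma measurable_statePotential (n : ℕ) :
    Measurable (statePotential (d := d) ε ρ G w N n) := by
  unfold statePotential
  refine Measurable.ite (measurable_snd (measurableSet_singleton true))
    (Measurable.ite (measurableSet_good G w) measurable_const measurable_const)
    (Measurable.ite (measurableSet_good _ w) (measurable_const.min ?_) measurable_const)
  exact ((measurable_potential n).comp
    ((measurable_angle_left w).comp measurable_fst)).ennreal_ofReal

lemma statePotential_le {s : Vec d × Bool} {n : ℕ} {x : ℝ} (hG : ε ≤ G) (hs : ‖s.1‖ = 1)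
    (hhalts : s.2 = true → InnerProductGeometry.angle s.1 w ≤ ε)
    (hs' : InnerProductGeometry.angle s.1 w ≤ ρ ^ 2 / 200)
    (hx : s.2 = false → potential d ε G N n (InnerProductGeometry.angle s.1 w) ≤ x) :
    statePotential ε ρ G w N n s ≤ ENNReal.ofReal x := by
  unfold statePotential
  split_ifs with h1 h2 h2
  · exact zero_le
  · exact absurd ⟨hs, (hhalts h1).trans hG⟩ h2
  · exact (min_le_right _ _).trans (ENNReal.ofReal_le_ofReal (hx (by simpa using h1)))
  · exact absurd ⟨hs, hs'⟩ h2

/-- The potential is a supermartingale along RefineEstimate. -/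
lemma lintegral_statePotential_le (hA : IsAccurate f ε₁ find w ρ) (hw : ‖w‖ = 1) (hd : 2 ≤ d)
    (hρ0 : 0 < ρ) (hρ : ρ ≤ 1 / 80) (hb0 : 0 < b) (hb : b ≤ ρ ^ 2 / 1000000) (hε : 0 < ε)
    (hε1 : ε ≤ 1) (hε₁0 : 0 < ε₁) (hε₁ : ε₁ ≤ b * ε / d) (hG : ε ≤ G) (n : ℕ) (s : Vec d × Bool) :
    ∫⁻ g, statePotential ε ρ G w N (n + 1) (refineStep f ε₁ (ε / 2) find s g)
      ∂(stdGaussian (Vec d)) ≤ statePotential ε ρ G w N n s := by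
  have hone : ∫⁻ g, statePotential ε ρ G w N (n + 1) (refineStep f ε₁ (ε / 2) find s g)
      ∂(stdGaussian (Vec d)) ≤ 1 :=
    (lintegral_mono fun g => statePotential_le_one _ _).trans (by simp)
  obtain ⟨z, flag⟩ := s
  cases flag with
  | true => simp [refineStep, statePotential]
  | false =>
    by_cases hreg : ‖z‖ = 1 ∧ InnerProductGeometry.angle z w ≤ ρ ^ 2 / 200
    swap
    · simpa only [statePotential, Bool.false_eq_true, if_false, if_neg hreg] using hone
    obtain ⟨hz, hθ⟩ := hreg
    have hval : statePotential ε ρ G w N n (z, false) =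
        min 1 (ENNReal.ofReal (potential d ε G N n (InnerProductGeometry.angle z w))) := by
      simp [statePotential, hz, hθ]
    rw [hval]
    refine le_min hone ?_
    have hd' : (2 : ℝ) ≤ d := by exact_mod_cast hd
    have hρρ : ρ ^ 2 / 200 ≤ ρ / 2 := by nlinarith
    have h0 := InnerProductGeometry.angle_nonneg z w
    have hb' : b ≤ 1 / 16000 := by nlinarith
    have hx0 : 0 < 1 / 200 / (d : ℝ) := by positivity
    have hx1 : 1 / 200 / (d : ℝ) ≤ 1 := by rw [div_le_one (by linarith)]; linarith
    have hesc := stdGaussian_escape_le (z := z) (w := w) hd hρ0 hρ hb0 (by linarith) hε hε1 hθ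
    have hrad : ∀ g : Vec d, ‖g‖ ^ 2 ≤
        (2 * ρ * d / (InnerProductGeometry.angle z w + b * ε)) ^ 2 →
        InnerProductGeometry.angle (candidate find z g) w ≤ ρ := fun g hg =>
      angle_candidate_le_radius hA hd hρ0 hb0 hε hε₁ hz (hθ.trans hρρ) hg
    have hnormMeas : ∀ R : ℝ, MeasurableSet {g : Vec d | ‖g‖ ^ 2 ≤ R} := fun R =>
      measurableSet_le (by fun_prop) measurable_const
    have hbad : MeasurableSet {g : Vec d | ¬ ‖g‖ ^ 2 ≤
        (2 * ρ * d / (InnerProductGeometry.angle z w + b * ε)) ^ 2} := (hnormMeas _).compl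
    rcases lt_or_ge (InnerProductGeometry.angle z w) (ε / 4) with hlow | hhigh
    · rw [potential_low hG hε hlow]
      have hm1 : InnerProductGeometry.angle z w + b * ε ≤ ε := by nlinarith
      have hβ : Real.exp (-d) / (100000 * d) * (InnerProductGeometry.angle z w + b * ε) ≤
          Real.exp (-d) / (100000 * d) * ε := by gcongr
      -- Here the favourable event is just an ordinary norm: the loop then stops at a good vector,
      -- and the potential drops to 0.
      refine (lintegral_le_of_favourable (x₁ := 0) (x₀ := Real.exp (-d) / 4 * ε) hbad
        (hnormMeas (10 * d)) (fun g => statePotential_le_one _ _) hesc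
        (stdGaussian_norm_sq_le_ge hd) le_rfl (by positivity) ?_ ?_).trans
        (ENNReal.ofReal_le_ofReal (potential_step_low hε hd hβ))
      · intro g hg
        obtain ⟨h1, h2, h3⟩ := refineStep_spec hA hd hρ0 hρ hb0 hb hε hε1 hε₁ hz hθ
          (hrad g (not_not.1 hg))
        have hmin0 : 0 < min (ε / 4) (ρ ^ 2 / 200) := lt_min (by linarith) (by positivity)
        have h4 : InnerProductGeometry.angle
              (refineStep f ε₁ (ε / 2) find (z, false) g).1 w < ε / 4 ∧
            InnerProductGeometry.angle
              (refineStep f ε₁ (ε / 2) find (z, false) g).1 w ≤ ρ ^ 2 / 200 := by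
          rcases h3 with h3 | h3
          · rw [h3]; exact ⟨hlow, hθ⟩
          · have hmax : 0 < max (InnerProductGeometry.angle z w) (min (ε / 4) (ρ ^ 2 / 200)) :=
              lt_max_of_lt_right hmin0
            have h5 := max_le hlow.le (min_le_left (ε / 4) (ρ ^ 2 / 200))
            have h6 := max_le hθ (min_le_right (ε / 4) (ρ ^ 2 / 200))
            constructor <;> nlinarith
        exact statePotential_le hG h1 h2 h4.2 fun _ => (potential_low hG hε h4.1).le
      · intro g hg
        have hg1 : InnerProductGeometry.angle (candidate find z g) w ≤ ρ := by
          apply hrad g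
          have hm0 : 0 < InnerProductGeometry.angle z w + b * ε := by positivity
          have h5 : 200 * (d : ℝ) ≤
              2 * ρ * d / (InnerProductGeometry.angle z w + b * ε) := by
            rw [le_div_iff₀ hm0]
            have : 100 * (InnerProductGeometry.angle z w + b * ε) ≤ ρ := by nlinarith
            nlinarith
          have h6 : (200 * (d : ℝ)) ^ 2 ≤
              (2 * ρ * d / (InnerProductGeometry.angle z w + b * ε)) ^ 2 :=
            pow_le_pow_left₀ (by positivity) h5 2
          have h7 : ‖g‖ ^ 2 ≤ 10 * d := hg
          nlinarith
        obtain ⟨h1, h2, h3⟩ := refineStep_spec hA hd hρ0 hρ hb0 hb hε hε1 hε₁ hz hθ hg1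
        have hst := stops_of_norm_le hA hd hb' hε hε₁0 hε₁ hz (hθ.trans (by linarith)) hg1 hlow.le hg
        have hflag : (refineStep f ε₁ (ε / 2) find (z, false) g).2 = true := by
          simp [refineStep, hst]
        simp [statePotential, hflag, h1, (h2 hflag).trans hG]
    · have hβ : Real.exp (-d) / (100000 * d) * (InnerProductGeometry.angle z w + b * ε) ≤
          Real.exp (-d) / (100000 * d) * (2 * InnerProductGeometry.angle z w) := by
        gcongr; nlinarith
      have hv : orthoPart z w ≠ 0 := by
        rw [← norm_pos_iff, norm_orthoPart hz hw]
        exact Real.sin_pos_of_pos_of_lt_pi (by linarith) (by nlinarith [Real.pi_gt_three])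
      have hfav : MeasurableSet {g : Vec d | ‖orthoPart z w‖ ≤ (inner ℝ (orthoPart z w) g : ℝ) ∧
          ‖g‖ ^ 2 ≤ 10 * d} :=
        (measurableSet_le measurable_const (measurable_inner_left _)).inter (hnormMeas _)
      have hcontr : (1 - 1 / 200 / d) * InnerProductGeometry.angle z w ≤
          InnerProductGeometry.angle z w := by nlinarith
      have hcontr0 : 0 ≤ (1 - 1 / 200 / d) * InnerProductGeometry.angle z w :=
        mul_nonneg (by linarith) h0
      have hmax : max (InnerProductGeometry.angle z w) (min (ε / 4) (ρ ^ 2 / 200)) =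
          InnerProductGeometry.angle z w := max_eq_left ((min_le_left _ _).trans hhigh)
      refine (lintegral_le_of_favourable hbad hfav (fun g => statePotential_le_one _ _) hesc
        (stdGaussian_favourable_ge hd hv) (potential_nonneg hε hG hcontr0)
        (potential_mono hε hG hcontr0 hcontr) ?_ ?_).trans
        (ENNReal.ofReal_le_ofReal (potential_step_high (N := N) (n := n) hε hG hd hhigh hβ))
      · intro g hg
        obtain ⟨h1, h2, h3⟩ := refineStep_spec hA hd hρ0 hρ hb0 hb hε hε1 hε₁ hz hθ
          (hrad g (not_not.1 hg))
        rw [hmax] at h3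
        have h4 : InnerProductGeometry.angle (refineStep f ε₁ (ε / 2) find (z, false) g).1 w ≤
            InnerProductGeometry.angle z w := by
          rcases h3 with h3 | h3
          · rw [h3]
          · exact h3.trans hcontr
        exact statePotential_le hG h1 h2 (h4.trans hθ) fun _ =>
          potential_mono hε hG (InnerProductGeometry.angle_nonneg _ _) h4
      · intro g hg
        have hg2 : ‖orthoPart z w‖ ≤ (inner ℝ (orthoPart z w) g : ℝ) ∧ ‖g‖ ^ 2 ≤ 10 * d := hg
        rw [norm_orthoPart hz hw] at hg2
        obtain ⟨hacc, hle⟩ := accepts_of_favourable hA hd hρ hb' hε hε₁ hz hw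
          (hθ.trans (by linarith)) hhigh hg2.2 hg2.1
        obtain ⟨h1, h2, -⟩ := refineStep_spec (g := g) hA hd hρ0 hρ hb0 hb hε hε1 hε₁ hz hθ
          (by linarith)
        have hfst : (refineStep f ε₁ (ε / 2) find (z, false) g).1 = candidate find z g := by
          simp [refineStep, hacc]
        refine statePotential_le hG h1 h2 ?_ fun _ => ?_ <;> rw [hfst]
        · linarith
        · exact potential_mono hε hG (InnerProductGeometry.angle_nonneg _ _) hle

/-- Lower bound for the probability that RefineEstimate reaches the angle `G`. -/
lemma refineEstimate_probability_ge (hA : IsAccurate f ε₁ find w ρ) (hw : ‖w‖ = 1) (hd : 2 ≤ d)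
    (hρ0 : 0 < ρ) (hρ : ρ ≤ 1 / 80) (hb0 : 0 < b) (hb : b ≤ ρ ^ 2 / 1000000) (hε : 0 < ε)
    (hε1 : ε ≤ 1) (hε₁0 : 0 < ε₁) (hε₁ : ε₁ ≤ b * ε / d) (hG : ε ≤ G)
    (hF : MeasurableSet {x | sgn (f x) = 1}) (hfind : Measurable find) (hz : ‖z‖ = 1)
    (hθ : InnerProductGeometry.angle z w ≤ ρ ^ 2 / 200) :
    1 - potential d ε G N 0 (InnerProductGeometry.angle z w) ≤ (sampleLaw d).real
      {g | ‖refineEstimate f ε₁ (ε / 2) find z N g‖ = 1 ∧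
        InnerProductGeometry.angle (refineEstimate f ε₁ (ε / 2) find z N g) w ≤ G} := by
  have hG0 : 0 < G := hε.trans_le hG
  have hstep : Measurable fun p : (Vec d × Bool) × Vec d =>
      refineStep f ε₁ (ε / 2) find p.1 p.2 := measurable_refineStep hF hfind
  have h0 : ∀ g, refineState f ε₁ (ε / 2) find z g 0 = (z, false) := fun _ => rfl
  have hs : ∀ g n, refineState f ε₁ (ε / 2) find z g (n + 1) =
      refineStep f ε₁ (ε / 2) find (refineState f ε₁ (ε / 2) find z g n) (g n) := fun _ _ => rfl
  have hmeas := measurable_recursion' hstep h0 hs N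
  have hint := lintegral_recursion_le (γ := stdGaussian (Vec d)) hstep h0 hs
    (measurable_statePotential (ε := ε) (ρ := ρ) (G := G) (w := w) (N := N))
    (lintegral_statePotential_le hA hw hd hρ0 hρ hb0 hb hε hε1 hε₁0 hε₁ hG) N
  set S := {g : ℕ → Vec d | ‖refineEstimate f ε₁ (ε / 2) find z N g‖ = 1 ∧
    InnerProductGeometry.angle (refineEstimate f ε₁ (ε / 2) find z N g) w ≤ G} with hS
  have hSm : MeasurableSet S := hmeas (measurableSet_good G w)
  have hprob : IsProbabilityMeasure (sampleLaw d) := by unfold sampleLaw; infer_instance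
  have hfail : sampleLaw d Sᶜ ≤
      ENNReal.ofReal (potential d ε G N 0 (InnerProductGeometry.angle z w)) := by
    calc sampleLaw d Sᶜ = ∫⁻ g, Sᶜ.indicator (fun _ => 1) g ∂(sampleLaw d) := by
          rw [lintegral_indicator_const hSm.compl, one_mul]
      _ ≤ ∫⁻ g, statePotential ε ρ G w N N (refineState f ε₁ (ε / 2) find z g N)
            ∂(sampleLaw d) := by
          refine lintegral_mono fun g => ?_
          by_cases hg : g ∈ S
          · rw [Set.indicator_of_notMem (by simpa using hg)]; exact zero_le
          · rw [Set.indicator_of_mem (show g ∈ Sᶜ from hg)]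
            have hg' : ¬ (‖(refineState f ε₁ (ε / 2) find z g N).1‖ = 1 ∧
                InnerProductGeometry.angle (refineState f ε₁ (ε / 2) find z g N).1 w ≤ G) := hg
            unfold statePotential
            rw [if_neg hg']
            split_ifs with h1 h2
            · rfl
            · refine le_min le_rfl (ENNReal.one_le_ofReal.2 ?_)
              have h3 : G < InnerProductGeometry.angle (refineState f ε₁ (ε / 2) find z g N).1 w :=
                not_le.1 fun h => hg' ⟨h2.1, h⟩
              have h4 : 1 ≤ (InnerProductGeometry.angle
                  (refineState f ε₁ (ε / 2) find z g N).1 w / G) ^ (200 * d) :=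
                one_le_pow₀ ((one_le_div hG0).2 h3.le)
              unfold potential
              -- At `n = N` the two geometric factors cancel, leaving `(θ/G)^{200 d} ≥ 1` for a
              -- vector that missed the target.
              rw [if_neg (not_le.2 h3), mul_assoc, ← mul_pow]
              norm_num
              have h5 := InnerProductGeometry.angle_nonneg
                (refineState f ε₁ (ε / 2) find z g N).1 w
              refine le_add_of_nonneg_of_le ?_ h4
              split_ifs <;> positivity
            · rfl
      _ ≤ statePotential ε ρ G w N 0 (z, false) := hint
      _ ≤ _ := by
          refine statePotential_le hG hz (by simp) hθ fun _ => le_rfl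
  have hreal : (sampleLaw d).real Sᶜ ≤
      potential d ε G N 0 (InnerProductGeometry.angle z w) :=
    ENNReal.toReal_le_of_le_ofReal
      (potential_nonneg hε hG (InnerProductGeometry.angle_nonneg _ _)) hfail
  rw [measureReal_compl hSm, probReal_univ] at hreal
  linarith

end Failure

/-! ### Separation of the weight vectors -/

lemma toEuclideanCLM_weight (W : Matrix (Fin d) (Fin d) ℝ) (x : Vec d) (i : Fin d) :
    Matrix.toEuclideanCLM (𝕜 := ℝ) W x i = inner ℝ (weight W i) x := by
  simp [weight, PiLp.inner_apply, Matrix.mulVec, dotProduct, mul_comm]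

/-- The vector `u = W⁻¹ e_i` satisfies `⟨w_i - w_j, u⟩ = 1` and, because a unit row forces `‖W‖ ≥
1`, `‖u‖ ≤ κ`. By Cauchy–Schwarz `‖w_i - w_j‖ ≥ 1/κ`, which for unit vectors is a bound on the inner
product. -/
lemma inner_weight_le {W : Matrix (Fin d) (Fin d) ℝ} (hW : ∀ j, ‖weight W j‖ = 1)
    (hdet : IsUnit W.det) {κ : ℝ} (hκ : condNumber W ≤ κ) {i j : Fin d} (hij : j ≠ i) :
    0 < κ ∧ (inner ℝ (weight W i) (weight W j) : ℝ) ≤ 1 - 1 / (2 * κ ^ 2) := by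
  have hone : 1 ≤ ‖Matrix.toEuclideanCLM (𝕜 := ℝ) W‖ := by
    have h1 := (Matrix.toEuclideanCLM (𝕜 := ℝ) W).le_opNorm (weight W i)
    have h2 := PiLp.norm_apply_le (Matrix.toEuclideanCLM (𝕜 := ℝ) W (weight W i)) i
    rw [toEuclideanCLM_weight, real_inner_self_eq_norm_sq, hW i] at h2
    rw [hW i, mul_one] at h1
    norm_num at h2
    linarith
  set u : Vec d := Matrix.toEuclideanCLM (𝕜 := ℝ) W⁻¹ (EuclideanSpace.single i 1) with hu
  have hWu : Matrix.toEuclideanCLM (𝕜 := ℝ) W u = EuclideanSpace.single i 1 := by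
    rw [hu, ← mul_apply_eq_comp, ← map_mul, Matrix.mul_nonsing_inv W hdet, map_one]
    rfl
  have hunorm : ‖u‖ ≤ κ := by
    have h1 := (Matrix.toEuclideanCLM (𝕜 := ℝ) W⁻¹).le_opNorm (EuclideanSpace.single i 1)
    rw [PiLp.norm_single, norm_one, mul_one] at h1
    refine h1.trans (le_trans ?_ hκ)
    exact le_mul_of_one_le_left (norm_nonneg _) hone
  have hdiff : (inner ℝ (weight W i - weight W j) u : ℝ) = 1 := by
    rw [inner_sub_left, ← toEuclideanCLM_weight, ← toEuclideanCLM_weight, hWu]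
    simp [hij]
  have hle := real_inner_le_norm (weight W i - weight W j) u
  rw [hdiff] at hle
  have hκ0 : 0 < κ := by
    by_contra! h
    have : ‖u‖ = 0 := le_antisymm (hunorm.trans h) (norm_nonneg _)
    rw [this] at hle; linarith
  refine ⟨hκ0, ?_⟩
  have h3 : 1 ≤ ‖weight W i - weight W j‖ * κ :=
    hle.trans (mul_le_mul_of_nonneg_left hunorm (norm_nonneg _))
  have h4 : 1 ≤ ‖weight W i - weight W j‖ ^ 2 * κ ^ 2 := by
    rw [← mul_pow]; exact one_le_pow₀ h3
  rw [norm_sub_sq_real, hW i, hW j] at h4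
  have h5 : 1 / (2 * κ ^ 2) ≤ 1 - (inner ℝ (weight W i) (weight W j) : ℝ) := by
    rw [div_le_iff₀ (by positivity)]; linarith
  linarith

/-! ### The main theorem -/

/-- The threshold makes the left side at most `d · d^{-50}`, and `d^{48} ≥ 80000`. The target is
chosen so that `40 η` becomes the relative accuracy `1/(2000 d)`. -/
lemma high_threshold_le (hd : 2 ≤ d) {δ t : ℝ} (hδ : 0 < δ)
    (ht : 20 / δ * Real.sqrt (Real.log d) ≤ t) :
    d * Real.exp (-(δ * t / 2) ^ 2 / 2) ≤ 1 / 80000 / d := by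
  have hd' : (2 : ℝ) ≤ d := by exact_mod_cast hd
  have hlog : 0 ≤ Real.log d := Real.log_nonneg (by linarith)
  have h1 : 10 * Real.sqrt (Real.log d) ≤ δ * t / 2 := by
    have := mul_le_mul_of_nonneg_left ht hδ.le
    rw [← mul_assoc, mul_div_cancel₀ _ hδ.ne'] at this
    linarith
  have h2 : 100 * Real.log d ≤ (δ * t / 2) ^ 2 := by
    have h3 := pow_le_pow_left₀ (by positivity) h1 2
    rw [mul_pow, Real.sq_sqrt hlog] at h3
    linarith
  have h3 : Real.exp (-(δ * t / 2) ^ 2 / 2) ≤ ((d : ℝ) ^ 50)⁻¹ := by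
    have : (d : ℝ) ^ 50 = Real.exp (50 * Real.log d) := by
      rw [mul_comm, Real.exp_mul, Real.exp_log (by linarith)]; norm_cast
    rw [this, ← Real.exp_neg]
    exact Real.exp_le_exp.2 (by linarith)
  have h4 : (80000 : ℝ) ≤ (d : ℝ) ^ 48 :=
    le_trans (by norm_num) (pow_le_pow_left₀ (by norm_num) hd' 48)
  calc d * Real.exp (-(δ * t / 2) ^ 2 / 2) ≤ d * ((d : ℝ) ^ 50)⁻¹ := by gcongr
    _ = ((d : ℝ) ^ 48)⁻¹ / d := by field_simp
    _ ≤ 1 / 80000 / d := by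
      rw [one_div]; gcongr

lemma isAccurate_network {W : Matrix (Fin d) (Fin d) ℝ} {coeff : Finset (Fin d) → ℝ} {t ε₁ δ : ℝ}
    {i : Fin d} {find : Vec d → ℝ × ℝ} (hd : 2 ≤ d) (hW : ∀ j, ‖weight W j‖ = 1)
    (hδ : 0 < δ) (hδ' : δ ≤ 1 / 2)
    (hsep : ∀ j, j ≠ i → (inner ℝ (weight W i) (weight W j) : ℝ) ≤ 1 - δ)
    (hf : ∀ x, sgn (network coeff W t x) = 1 ↔ ∃ j, t < (inner ℝ (weight W j) x : ℝ))
    (ht : 20 / δ * Real.sqrt (Real.log d) ≤ t) (hε₁ : 0 < ε₁) (hε₁' : ε₁ ≤ δ / 20)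
    (hfind : IsThresholdRule (network coeff W t) ε₁ find) :
    IsAccurate (network coeff W t) ε₁ find (weight W i) (δ / 40) := by
  have hd' : (2 : ℝ) ≤ d := by exact_mod_cast hd
  have hη := high_threshold_le hd hδ ht
  have hη0 : (0 : ℝ) < 1 / 80000 / d := by positivity
  have hη' : 1 / 80000 / (d : ℝ) ≤ 1 / 100 := by
    rw [div_le_iff₀ (by linarith)]; linarith
  have ht1 : 1 ≤ t := by
    refine le_trans ?_ ht
    have h1 : 1 / 2 ≤ Real.sqrt (Real.log d) := by
      apply Real.le_sqrt_of_sq_le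
      have := Real.log_two_gt_d9
      have := Real.log_le_log (by norm_num) hd'
      linarith
    have h2 : 20 ≤ 20 / δ := by rw [le_div_iff₀ hδ]; linarith
    nlinarith
  have hpair : ∀ z, ‖z‖ = 1 → InnerProductGeometry.angle z (weight W i) ≤ δ / 40 →
      IsThresholdPair (network coeff W t) ε₁ z (find z) := fun z hz hθ =>
    hfind.finds z hz (exists_isThresholdPair hf hW hδ hδ' hsep ht1 hη hη' hε₁ hε₁' hz hθ)
  refine ⟨hpair, fun z hz hθ => ?_⟩
  have := abs_estimate_sub_angle_le hf hW hδ hδ' hsep ht1 hη hη0 hη' hε₁ hε₁' hz hθ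
    (hpair z hz hθ)
  have h2 : 40 * (1 / 80000 / (d : ℝ)) = 1 / 2000 / d := by ring
  rw [h2] at this
  exact this

/-! ### Size of the initial potential -/

lemma pow_197_le (N : ℕ) : (197 / 200 : ℝ) ^ N ≤ Real.exp (-(3 / 200 * N)) := by
  have h1 : (197 / 200 : ℝ) ≤ Real.exp (-(3 / 200)) := by
    linarith [Real.add_one_le_exp (-(3 / 200) : ℝ)]
  refine (pow_le_pow_left₀ (by norm_num) h1 N).trans_eq ?_
  rw [← Real.exp_nat_mul]; congr 1; ring

/-- Asking for `T` contractions makes the power at most `e^{2T}`, while `N ≥ 14000 T` iterations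
give a factor below `e^{-3T}`. -/
lemma potential_le_of_contractions {ε θ γ : ℝ} {T N : ℕ} (hd : 2 ≤ d) (hε : 0 < ε) (hε1 : ε ≤ 1)
    (hθ0 : 0 ≤ θ) (hθ1 : θ ≤ 1) (hγ : θ ≤ γ) (hN : 14000 * (T : ℝ) ≤ N) :
    potential d ε (max ((1 - 1 / 200 / d) ^ T * γ) ε) N 0 θ ≤
      Real.exp (-T) + Real.exp (-d) := by
  have hd' : (2 : ℝ) ≤ d := by exact_mod_cast hd
  have hE := Real.exp_pos (-(d : ℝ))
  unfold potential
  have hV : Real.exp (-(d : ℝ)) / 4 * (ε + if ε / 4 ≤ θ then θ else 0) ≤ Real.exp (-d) := by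
    have : (if ε / 4 ≤ θ then θ else 0) ≤ 1 := by split_ifs <;> linarith
    nlinarith
  rw [add_comm]
  refine add_le_add ?_ hV
  split_ifs with h
  · positivity
  set G := max ((1 - 1 / 200 / (d : ℝ)) ^ T * γ) ε with hG
  have hG0 : 0 < G := lt_max_of_lt_right hε
  have hθG : G < θ := not_le.1 h
  set y : ℝ := 1 - 1 / 200 / (d : ℝ) with hy
  have hy0 : 0 < y := by
    have : 1 / 200 / (d : ℝ) ≤ 1 / 2 := by rw [div_le_iff₀ (by linarith)]; linarith
    rw [hy]; linarith
  have h1 : θ / G * y ^ T ≤ 1 := by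
    rw [div_mul_eq_mul_div, div_le_one hG0]
    calc θ * y ^ T ≤ γ * y ^ T := by gcongr
      _ ≤ G := by rw [mul_comm]; exact le_max_left _ _
  have h2 : (θ / G) ^ (200 * d) * Real.exp (-(2 * T)) ≤ 1 := by
    have h3 : Real.exp (-(2 * T)) ≤ (y ^ T) ^ (200 * d) := by
      rw [← pow_mul, mul_comm T, pow_mul]
      calc Real.exp (-(2 * T)) = Real.exp (-2) ^ T := by
            rw [← Real.exp_nat_mul]; congr 1; ring
        _ ≤ _ := pow_le_pow_left₀ (Real.exp_pos _).le (exp_le_one_sub_inv_pow hd) T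
    calc _ ≤ (θ / G) ^ (200 * d) * (y ^ T) ^ (200 * d) := by gcongr
      _ = (θ / G * y ^ T) ^ (200 * d) := (mul_pow _ _ _).symm
      _ ≤ 1 := pow_le_one₀ (by positivity) h1
  have h4 : (197 / 200 : ℝ) ^ N ≤ Real.exp (-(2 * T)) * Real.exp (-T) := by
    refine (pow_197_le N).trans ?_
    rw [← Real.exp_add]
    apply Real.exp_le_exp.2
    have : (0 : ℝ) ≤ T := Nat.cast_nonneg T
    linarith
  calc _ ≤ (θ / G) ^ (200 * d) * (Real.exp (-(2 * T)) * Real.exp (-T)) := by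
        rw [pow_zero, mul_one]; gcongr
    _ = (θ / G) ^ (200 * d) * Real.exp (-(2 * T)) * Real.exp (-T) := by ring
    _ ≤ 1 * Real.exp (-T) := by gcongr
    _ = _ := one_mul _

/-- If `θ > ε`, then `log (1/ε) ≥ 1` because `θ ≤ e^{-1}`. The power is at most `e^{200 d log(1/ε)}`
and the decay at most `e^{-210 d log(1/ε)}`; the surplus exceeds `d + 1`. -/
lemma potential_le_of_log {ε θ : ℝ} {N : ℕ} (hd : 2 ≤ d) (hε : 0 < ε) (hε1 : ε ≤ 1)
    (hθ0 : 0 ≤ θ) (hθ1 : θ ≤ Real.exp (-1)) (hN : 14000 * d * Real.log (1 / ε) ≤ N) :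
    potential d ε ε N 0 θ ≤ Real.exp (-d) := by
  have hd' : (2 : ℝ) ≤ d := by exact_mod_cast hd
  have hE := Real.exp_pos (-(d : ℝ))
  have hθ1' : θ ≤ 1 := hθ1.trans (Real.exp_le_one_iff.2 (by norm_num))
  unfold potential
  have hV : Real.exp (-(d : ℝ)) / 4 * (ε + if ε / 4 ≤ θ then θ else 0) ≤ Real.exp (-d) / 2 := by
    have : (if ε / 4 ≤ θ then θ else 0) ≤ 1 := by split_ifs <;> linarith
    nlinarith
  have hU : (if θ ≤ ε then 0 else (θ / ε) ^ (200 * d) * (197 / 200 : ℝ) ^ N * (200 / 197) ^ 0) ≤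
      Real.exp (-d) / 2 := by
    split_ifs with h
    · positivity
    set l := Real.log (1 / ε) with hl
    have hl1 : 1 ≤ l := by
      rw [hl, Real.le_log_iff_exp_le (by positivity), le_div_iff₀ hε]
      have h1 : ε ≤ Real.exp (-1) := (not_le.1 h).le.trans hθ1
      calc Real.exp 1 * ε ≤ Real.exp 1 * Real.exp (-1) := by gcongr
        _ = 1 := by rw [← Real.exp_add]; norm_num
    have h2 : (θ / ε) ^ (200 * d) ≤ Real.exp (200 * d * l) := by
      calc (θ / ε) ^ (200 * d) ≤ (1 / ε) ^ (200 * d) := by gcongr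
        _ = Real.exp l ^ (200 * d) := by rw [hl, Real.exp_log (by positivity)]
        _ = _ := by rw [← Real.exp_nat_mul]; congr 1; push_cast; ring
    calc _ ≤ Real.exp (200 * d * l) * Real.exp (-(3 / 200 * N)) := by
          rw [pow_zero, mul_one]
          exact mul_le_mul h2 (pow_197_le N) (by positivity) (Real.exp_pos _).le
      _ = Real.exp (200 * d * l + -(3 / 200 * N)) := (Real.exp_add _ _).symm
      _ ≤ Real.exp (-d + -1) := by
          apply Real.exp_le_exp.2
          have h3 : (d : ℝ) * 1 ≤ d * l := by gcongr
          linarith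
      _ = Real.exp (-d) * Real.exp (-1) := Real.exp_add _ _
      _ ≤ Real.exp (-d) * (1 / 2) := by
          gcongr
          rw [Real.exp_neg, one_div]
          exact inv_anti₀ (by norm_num) (by linarith [Real.add_one_le_exp (1 : ℝ)])
      _ = _ := by ring
  linarith

end HighThreshold

theorem mainTheorem3 :
    ∃ c C p : ℝ, 0 < c ∧ c < 1 ∧ 0 < C ∧ 0 < p ∧
    ∀ κ : ℝ, ∃ (A b : ℝ) (q : ℕ), 0 < A ∧ 0 < b ∧
    ∀ (d : ℕ), 2 ≤ d →
    ∀ (W : Matrix (Fin d) (Fin d) ℝ) (coeff : Finset (Fin d) → ℝ) (t : ℝ) (i : Fin d),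
      (∀ j, ‖HighThreshold.weight W j‖ = 1) →
      IsUnit W.det →
      HighThreshold.condNumber W ≤ κ →
      coeff ∅ = 0 →
      (∀ j, 0 < coeff {j}) →
      MonotoneOn (HighThreshold.polyEval coeff) {X | ∀ j, X j = 0 ∨ X j = 1} →
      A * Real.sqrt (Real.log d) ≤ t →
    ∀ (ε ε₁ : ℝ), 0 < ε → ε < 1 → 0 < ε₁ → ε₁ ≤ b * ε / d →
    ∀ (find : HighThreshold.Vec d → ℝ × ℝ),
      HighThreshold.IsThresholdRule (HighThreshold.network coeff W t) ε₁ find →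
    ∀ (z : HighThreshold.Vec d), ‖z‖ = 1 →
      InnerProductGeometry.angle z (HighThreshold.weight W i) ≤ 1 / (d : ℝ) ^ q →
      -- one iteration, as long as the angle is not yet below `ε`
      (ε ≤ InnerProductGeometry.angle z (HighThreshold.weight W i) →
        p ≤ (ProbabilityTheory.stdGaussian (HighThreshold.Vec d)).real
          {g | HighThreshold.Accepts (HighThreshold.network coeff W t) ε₁ find z g ∧
            InnerProductGeometry.angle (HighThreshold.candidate find z g)
                (HighThreshold.weight W i) ≤
              (1 - c / d) * InnerProductGeometry.angle z (HighThreshold.weight W i)} ∧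
        (ProbabilityTheory.stdGaussian (HighThreshold.Vec d)).real
          {g | HighThreshold.Accepts (HighThreshold.network coeff W t) ε₁ find z g ∧
            ¬ InnerProductGeometry.angle (HighThreshold.candidate find z g)
                (HighThreshold.weight W i) ≤
              (1 - c / d) * InnerProductGeometry.angle z (HighThreshold.weight W i)} ≤
          Real.exp (-d)) ∧
      -- `O(T)` iterations
      (∀ γ : ℝ, InnerProductGeometry.angle z (HighThreshold.weight W i) ≤ γ →
        ∀ T N : ℕ, C * T ≤ N →
          1 - Real.exp (-T) - Real.exp (-d) ≤ (HighThreshold.sampleLaw d).real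
            {g | ‖HighThreshold.refineEstimate (HighThreshold.network coeff W t)
                  ε₁ (ε / 2) find z N g‖ = 1 ∧
              InnerProductGeometry.angle
                (HighThreshold.refineEstimate (HighThreshold.network coeff W t)
                  ε₁ (ε / 2) find z N g)
                (HighThreshold.weight W i) ≤ max ((1 - c / d) ^ T * γ) ε}) ∧
      -- `O(d log (1 / ε))` iterations
      (∀ N : ℕ, C * d * Real.log (1 / ε) ≤ N →
        1 - Real.exp (-d) ≤ (HighThreshold.sampleLaw d).real
          {g | ‖HighThreshold.refineEstimate (HighThreshold.network coeff W t)
                ε₁ (ε / 2) find z N g‖ = 1 ∧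
            InnerProductGeometry.angle
              (HighThreshold.refineEstimate (HighThreshold.network coeff W t)
                ε₁ (ε / 2) find z N g)
              (HighThreshold.weight W i) ≤ ε}) := by
  -- `1/200` is the true decrease guaranteed by acceptance, `3/100` the probability of a favourable
  -- perturbation, and `14000 = 210 · 200/3` turns the decay rate `3/200` into `210`.
  refine ⟨1 / 200, 14000, 3 / 100, by norm_num, by norm_num, by norm_num, by norm_num, fun κ => ?_⟩
  -- The maximum with 1 ensures `0 < δ ≤ 1/2` for every real `κ`.
  set δ : ℝ := 1 / (2 * max κ 1 ^ 2) with hδ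
  have hκ1 : 1 ≤ max κ 1 := le_max_right _ _
  have hδ0 : 0 < δ := by positivity
  have hδ' : δ ≤ 1 / 2 := by
    rw [hδ]; apply one_div_le_one_div_of_le (by norm_num); nlinarith
  set ρ : ℝ := δ / 40 with hρ
  have hρ0 : 0 < ρ := by positivity
  have hρ' : ρ ≤ 1 / 80 := by rw [hρ]; linarith
  -- The exponent must not depend on `d`; since `d ≥ 2`, `d^{-q} ≤ 2^{-q}` puts the start within
  -- `ρ²/200`.
  obtain ⟨q, hq⟩ := exists_pow_lt_of_lt_one (show 0 < ρ ^ 2 / 200 by positivity)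
    (show (1 / 2 : ℝ) < 1 by norm_num)
  refine ⟨20 / δ, ρ ^ 2 / 1000000, q, by positivity, by positivity, ?_⟩
  intro d hd W coeff t i hW hdet hcond hc0 hc1 hmono ht ε ε₁ hε hε1 hε₁0 hε₁ find hfind z hz hangle
  have hd' : (2 : ℝ) ≤ d := by exact_mod_cast hd
  have hf := HighThreshold.sgn_network_eq_one_iff hc0 hc1 hmono W t
  have hsep : ∀ j, j ≠ i →
      (inner ℝ (HighThreshold.weight W i) (HighThreshold.weight W j) : ℝ) ≤ 1 - δ := fun j hj =>
    (HighThreshold.inner_weight_le hW hdet (hcond.trans (le_max_left κ 1)) hj).2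
  have hε₁' : ε₁ ≤ δ / 20 := by
    refine hε₁.trans ((div_le_self (by positivity) (by linarith)).trans ?_)
    have : ρ ^ 2 / 1000000 * ε ≤ ρ ^ 2 / 1000000 := mul_le_of_le_one_right (by positivity) hε1.le
    nlinarith
  have hA := HighThreshold.isAccurate_network hd hW hδ0 hδ' hsep hf ht hε₁0 hε₁' hfind
  rw [← hρ] at hA
  have hθ : InnerProductGeometry.angle z (HighThreshold.weight W i) ≤ ρ ^ 2 / 200 := by
    refine hangle.trans (le_trans ?_ hq.le)
    rw [one_div_pow]
    exact one_div_le_one_div_of_le (by positivity) (pow_le_pow_left₀ (by norm_num) hd' q)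
  have hθ0 := InnerProductGeometry.angle_nonneg z (HighThreshold.weight W i)
  have hb0 : 0 < ρ ^ 2 / 1000000 := by positivity
  have hb1 : ρ ^ 2 / 1000000 ≤ 1 / 16000 := by nlinarith
  have hθs : InnerProductGeometry.angle z (HighThreshold.weight W i) ≤ 1 / 4 := by nlinarith
  refine ⟨fun hεθ => ⟨?_, ?_⟩, fun γ hγ T N hN => ?_, fun N hN => ?_⟩
  · exact HighThreshold.favourable_probability hA hd hρ' hb1 hε hε₁ hz (hW i)
      (hθ.trans (by nlinarith)) (by linarith)
  · exact HighThreshold.misleading_probability hA hd hρ0 hρ' hb0 (by linarith) hε hε1.le hε₁ hz hθ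
      (by linarith)
  · have h := HighThreshold.refineEstimate_probability_ge (N := N) hA (hW i) hd hρ0 hρ' hb0 le_rfl
      hε hε1.le hε₁0 hε₁ (le_max_right ((1 - 1 / 200 / (d : ℝ)) ^ T * γ) ε)
      (HighThreshold.measurableSet_fires hf) hfind.measurable hz hθ
    have h2 := HighThreshold.potential_le_of_contractions hd hε hε1.le hθ0 (by linarith) hγ hN
    linarith
  · have h := HighThreshold.refineEstimate_probability_ge (N := N) hA (hW i) hd hρ0 hρ' hb0 le_rfl
      hε hε1.le hε₁0 hε₁ le_rfl (HighThreshold.measurableSet_fires hf) hfind.measurable hz hθ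
    have hexp : (1 / 4 : ℝ) ≤ Real.exp (-1) := by
      rw [Real.exp_neg, one_div]
      exact inv_anti₀ (Real.exp_pos 1) (by linarith [Real.exp_one_lt_d9])
    have h2 := HighThreshold.potential_le_of_log hd hε hε1.le hθ0 (hθs.trans hexp) hN
    linarith
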